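/- Let $p>3$ be a prime and let $i>1$ be an integer not divisible by $p$. With $(a;q)_\infty=\prod_{k\ge 0}(1-aq^k)$, write $$\frac{(q^i;q^i)_\infty}{(q^p;q^p)_\infty}=\sum_{n=0}^\infty a_nq^n .$$ For $0\le r\le p-1$ let, when $p\equiv 1\pmod 3$, $$\mathcal L(r)=\begin{cases}6r^2+r & \text{if } r\le\frac{4p-1}{12},\\ 6r^2+r-8pr+\frac{8p^2-2p}{3} & \text{if } \frac{4p-1}{12}<r\le\frac{10p-1}{12},\\ 6r^2+r-12pr+(6p^2-p) & \text{if } r>\frac{10p-1}{12},\end{cases}$$ and, when $p\equiv -1\pmod 3$, $$\mathcal L(r)=\begin{cases}6r^2+r & \text{if } r\le\frac{2p-1}{12},\\ 6r^2+r-4pr+\frac{2p^2-p}{3} & \text{if } \frac{2p-1}{12}<r\le\frac{8p-1}{12},\\ 6r^2+r-12pr+(6p^2-p) & \text{if } r>\frac{8p-1}{12}.\end{cases}$$ For $0\le s\le p-1$ let $V_s=\{\,i\mathcal L(r): 0\le r\le p-1,\ i\mathcal L(r)\equiv s\pmod p\,\}$, and put $$N=N(p,i)=\max\{\min V_s: 0\le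 s\le p-1,\ V_s\ne\emptyset\}-p .$$ Then the following hold. 1. For every $n\ge 0$, if $n\not\equiv i(6r^2+r)\pmod p$ for all $0\le r\le p-1$, then $a_n=0$. 2. If $p\equiv 1\pmod 3$, $n\ge 0$ and $n>N$, and $n\equiv i(6r^2+r)\pmod p$ for some $0\le r\le p-1$, then $a_n>0$ if $r\le\frac{4p-1}{12}$ or $r>\frac{10p-1}{12}$, and $a_n<0$ if $\frac{4p-1}{12}<r\le\frac{10p-1}{12}$. 3. If $p\equiv -1\pmod 3$, $n\ge 0$ and $n>N$, and $n\equiv i(6r^2+r)\pmod p$ for some $0\le r\le p-1$, then $a_n>0$ if $r\le\frac{2p-1}{12}$ or $r>\frac{8p-1}{12}$, and $a_n<0$ if $\frac{2p-1}{12}<r\le\frac{8p-1}{12}$. -/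

import Mathlib

open scoped PowerSeries PowerSeries.WithPiTopology

namespace SignPattern

/-- The infinite `q`-Pochhammer symbol `(a; q)_∞ = ∏_{k ≥ 0} (1 - a q^k)` for formal power series
with integer coefficients, where infinite products are taken coefficientwise. -/
noncomputable def qPochhammerInf (a q : ℤ⟦X⟧) : ℤ⟦X⟧ := ∏' k : ℕ, (1 - a * q ^ k)

/-- The series `(q^m; q^m)_∞`, where the formal variable `X` plays the role of `q`. -/
noncomputable def eulerProd (m : ℕ) : ℤ⟦X⟧ :=
  qPochhammerInf (PowerSeries.X ^ m) (PowerSeries.X ^ m)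

/-- For `m ≥ 1` the infinite product defining `(q^m; q^m)_∞` converges. -/
theorem multipliable_eulerProd {m : ℕ} (hm : 0 < m) :
    Multipliable fun k : ℕ =>
      (1 - (PowerSeries.X : ℤ⟦X⟧) ^ m * (PowerSeries.X ^ m) ^ k) := by
  simp_rw [sub_eq_add_neg]
  apply PowerSeries.WithPiTopology.multipliable_one_add_of_tendsto_order_atTop_nhds_top
  simp_rw [PowerSeries.order_neg, ← pow_succ', ← pow_mul, PowerSeries.order_X_pow]
  refine ENat.tendsto_nhds_top_iff_natCast_lt.mpr fun n => ?_
  filter_upwards [Filter.eventually_ge_atTop n] with k hk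
  exact_mod_cast (by nlinarith : n < m * (k + 1))

theorem constantCoeff_eulerProd {m : ℕ} (hm : 0 < m) :
    PowerSeries.constantCoeff (eulerProd m) = 1 := by
  have h := (multipliable_eulerProd hm).map_tprod
    (PowerSeries.constantCoeff (R := ℤ)) (PowerSeries.WithPiTopology.continuous_constantCoeff ℤ)
  have h0 : m ≠ 0 := hm.ne'
  simpa [eulerProd, qPochhammerInf, h0] using h

/-- The quotient `(q^i; q^i)_∞ / (q^p; q^p)_∞` has a unique expansion `∑ a_n q^n`. -/
theorem existsUnique_coeff {p : ℕ} (i : ℕ) (hp : 0 < p) :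
    ∃! a : ℕ → ℤ, PowerSeries.mk a * eulerProd p = eulerProd i := by
  obtain ⟨u, hu⟩ : IsUnit (eulerProd p) := by
    rw [PowerSeries.isUnit_iff_constantCoeff, constantCoeff_eulerProd hp]
    exact isUnit_one
  have hmk : ∀ f : ℤ⟦X⟧, PowerSeries.mk (fun n => PowerSeries.coeff n f) = f := fun f => by
    ext n; simp
  refine ⟨fun n => PowerSeries.coeff n (eulerProd i * (↑u⁻¹ : ℤ⟦X⟧)), ?_, fun b hb => ?_⟩
  · simp only [hmk, ← hu, Units.inv_mul_cancel_right]
  · funext n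
    rw [← hb, ← hu, Units.mul_inv_cancel_right, PowerSeries.coeff_mk]

/-- The lower cut-point: `(4p-1)/12` if `p ≡ 1 (mod 3)`, and `(2p-1)/12` if `p ≡ -1 (mod 3)`. -/
def cutLow (p : ℕ) : ℚ := if p ≡ 1 [MOD 3] then (4 * p - 1) / 12 else (2 * p - 1) / 12

/-- The upper cut-point: `(10p-1)/12` if `p ≡ 1 (mod 3)`, and `(8p-1)/12` if `p ≡ -1 (mod 3)`. -/
def cutHigh (p : ℕ) : ℚ := if p ≡ 1 [MOD 3] then (10 * p - 1) / 12 else (8 * p - 1) / 12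

/-- The piecewise quadratic `𝓛(r)`. The divisions by `3` are exact when `p ≡ 1`, respectively
`p ≡ -1`, modulo `3`. -/
def calL (p r : ℕ) : ℤ :=
  if (r : ℚ) ≤ cutLow p then 6 * (r : ℤ) ^ 2 + r
  else if (r : ℚ) ≤ cutHigh p then
    if p ≡ 1 [MOD 3] then
      6 * (r : ℤ) ^ 2 + r - 8 * p * r + (8 * (p : ℤ) ^ 2 - 2 * p) / 3
    else
      6 * (r : ℤ) ^ 2 + r - 4 * p * r + (2 * (p : ℤ) ^ 2 - p) / 3
  else 6 * (r : ℤ) ^ 2 + r - 12 * p * r + (6 * (p : ℤ) ^ 2 - p)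

/-- The values `i 𝓛(r)`, `0 ≤ r ≤ p - 1`, that are congruent to `s` modulo `p`. -/
def classValues (p i s : ℕ) : Finset ℤ :=
  ((Finset.range p).image fun r => (i : ℤ) * calL p r).filter fun x => x ≡ s [ZMOD p]

/-- The minima of the nonempty sets among `classValues p i s`, `0 ≤ s ≤ p - 1`. -/
def classMinima (p i : ℕ) : Finset ℤ :=
  (Finset.range p).biUnion fun s =>
    (classValues p i s).filter fun m => ∀ x ∈ classValues p i s, m ≤ x

/-- `N(p, i) = max (⋃_s min {i 𝓛(r) : i 𝓛(r) ≡ s (mod p), 0 ≤ r ≤ p - 1}) - p`. The default value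
`0` of the maximum is used only for the empty set, which does not occur for `p ≥ 1`. -/
def boundN (p i : ℕ) : ℤ := (classMinima p i).max.unbotD 0 - p

theorem classMinima_nonempty {p : ℕ} (i : ℕ) (hp : 0 < p) : (classMinima p i).Nonempty := by
  have hpz : (0 : ℤ) < p := by exact_mod_cast hp
  set v : ℤ := (i : ℤ) * calL p 0 with hv
  set s : ℕ := (v % p).toNat with hs
  have h0 : 0 ≤ v % p := Int.emod_nonneg _ hpz.ne'
  have hcast : (s : ℤ) = v % p := Int.toNat_of_nonneg h0
  have hlt : s < p := by
    have := Int.emod_lt_of_pos v hpz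
    omega
  have hne : (classValues p i s).Nonempty := by
    refine ⟨v, Finset.mem_filter.mpr ⟨Finset.mem_image.mpr ⟨0, by simpa using hp, rfl⟩, ?_⟩⟩
    rw [hcast]
    exact (Int.mod_modEq v p).symm
  refine ⟨(classValues p i s).min' hne, Finset.mem_biUnion.mpr ⟨s, by simpa using hlt, ?_⟩⟩
  exact Finset.mem_filter.mpr ⟨Finset.min'_mem _ _, fun x hx => Finset.min'_le _ _ hx⟩

/-- `N(p, i) + p` is the maximum of the set of minima. -/
theorem isGreatest_boundN {p : ℕ} (i : ℕ) (hp : 0 < p) :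
    IsGreatest (classMinima p i : Set ℤ) (boundN p i + p) := by
  have h := classMinima_nonempty i hp
  have e : boundN p i + p = (classMinima p i).max' h := by
    simp [boundN, ← Finset.coe_max' h]
  rw [e]
  exact (classMinima p i).isGreatest_max' h

end SignPattern

/-! Since (q^p;q^p)_∞ is a series in q^p, extracting the exponents congruent to s mod p turns the
quotient into (section of (q^i;q^i)_∞) / (q;q)_∞ (`progSection_mul_eulerProd_one`). By the
pentagonal number theorem the numerator is Σ (-1)^k q^{i k(3k-1)/2}. Choose ε = ±1 and c with 6c = 1
- εp, the vertex of this quadratic mod p. The indices k in one residue class are then exactly c ±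
ε(w + pt), where 0 ≤ w < p/2 is fixed and t is an integer. Hence each nonzero section is a sign
(-1)^{c+εw} times a monomial times a quintuple product series with parameters u = iw, v = ip; for w
= 0 it is an Euler product instead (`progSection_eulerProd`, `progSection_eulerProd_zero`).

The quintuple product identity (`quintSeries_mul`), obtained as a limit of a telescoping finite
identity, writes that series as a product of distinct factors 1 - q^n over further such factors. The
numerator factors all occur in (q;q)_∞ and 1 - q is not among them, so after cancellation 1/(1 - q)
survives and every coefficient is positive (`coeff_pos_of_mul_eq_quintSeries`). Along the class, a_n
therefore has the sign (-1)^{c+εw} from the first exponent i·pentagonal(c + εw) onwards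
(`coeff_sign`).

Finally, 𝓛(r) is the pentagonal number of the index c + εκ with |κ| < p/2 in the class of 6r² + r,
and the cut-points record the parity of that index (`exists_isIndex`). The condition n > N says
precisely enough to place n at or beyond the minimum of its class (`exists_mul_calL_le`). -/

open scoped PowerSeries PowerSeries.WithPiTopology

namespace SignPattern

/-! ### A finite quintuple product identity, by telescoping. -/

section FiniteQuintuple

variable {K : Type*} [Field K]

/-- The finite `q`-Pochhammer symbol `(a; q)_n`. -/
def qPoch (a q : K) (n : ℕ) : K := ∏ l ∈ Finset.range n, (1 - a * q ^ l)

theorem qPoch_zero (a q : K) : qPoch a q 0 = 1 := by simp [qPoch]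

theorem qPoch_succ (a q : K) (n : ℕ) : qPoch a q (n + 1) = qPoch a q n * (1 - a * q ^ n) := by
  simp [qPoch, Finset.prod_range_succ]

theorem qPoch_add (a q : K) (m n : ℕ) :
    qPoch a q (m + n) = qPoch a q m * qPoch (a * q ^ m) q n := by
  simp [qPoch, Finset.prod_range_add, pow_add, mul_assoc]

theorem qPoch_succ' (a q : K) (n : ℕ) :
    qPoch a q (n + 1) = (1 - a) * qPoch (a * q) q n := by
  rw [add_comm, qPoch_add]; simp [qPoch]

theorem qPoch_ne_zero {a q : K} {n : ℕ} (h : ∀ l < n, a * q ^ l ≠ 1) : qPoch a q n ≠ 0 :=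
  Finset.prod_ne_zero_iff.mpr fun l hl => sub_ne_zero.mpr (h l (Finset.mem_range.mp hl)).symm

/-- Factor by factor, 1 - a q^{-l} = -a q^{-l} (1 - q^l / a) for l = 1, …, n. -/
theorem qPoch_reverse {a q : K} (ha : a ≠ 0) (hq : q ≠ 0) (n : ℕ) :
    qPoch (a * (q ^ n)⁻¹) q n * q ^ (n * (n + 1) / 2) = (-a) ^ n * qPoch (q * a⁻¹) q n := by
  induction n with
  | zero => simp [qPoch]
  | succ n ih =>
    have e : (n + 1) * (n + 1 + 1) / 2 = n * (n + 1) / 2 + (n + 1) := by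
      rw [← Nat.add_mul_div_right _ _ (by norm_num : 0 < 2)]
      congr 1; ring
    have e2 : a * (q ^ (n + 1))⁻¹ * q = a * (q ^ n)⁻¹ := by
      rw [pow_succ]
      field_simp
    rw [qPoch_succ', e2, qPoch_succ, e, pow_add q, pow_succ (-a)]
    calc _ = (1 - a * (q ^ (n + 1))⁻¹) * q ^ (n + 1)
          * (qPoch (a * (q ^ n)⁻¹) q n * q ^ (n * (n + 1) / 2)) := by ring
      _ = _ := by
        rw [ih]
        field_simp
        ring

/-- The `(i, j)` summand of the finite quintuple product identity of order `i + j`. -/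
def quintTerm (z q : K) (i j : ℕ) : K :=
  (1 + z * q ^ i) * z ^ i * q ^ (i ^ 2) * qPoch q q (i + j) * qPoch z q (i + j + 1) /
    (qPoch q q i * qPoch q q j * qPoch (z ^ 2 * q ^ i) q (i + j + 1))

/-- The partial sums of the difference between consecutive orders have a closed form. The order is k
+ j, so keeping j general lets the induction on k run at fixed order. At j = 0 the closed form is
the negative of the one extra term of the next order, which is how `sum_quintTerm` uses it. -/
theorem sum_quintTerm_sub {z q : K} (hq1 : ∀ n : ℕ, q ^ (n + 1) ≠ 1)
    (hz : ∀ n : ℕ, z ^ 2 * q ^ n ≠ 1) (k : ℕ) (j : ℕ) :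
    ∑ i ∈ Finset.range (k + 1),
        (quintTerm z q i (k + j - i + 1) - quintTerm z q i (k + j - i)) =
      -(qPoch z q (k + j + 1) * z ^ (k + 1) * q ^ (k ^ 2 + (k + j) + k + 1) * qPoch q q (k + j)) /
        (qPoch q q k * qPoch q q j * qPoch (z ^ 2 * q ^ (k + 1)) q (k + j + 1)) := by
  have hqq : ∀ n, qPoch q q n ≠ 0 := fun n => qPoch_ne_zero fun l _ => by
    rw [← pow_succ']; exact hq1 l
  have hzz : ∀ i n, qPoch (z ^ 2 * q ^ i) q n ≠ 0 := fun i n => qPoch_ne_zero fun l _ => by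
    rw [mul_assoc, ← pow_add]; exact hz _
  have h1 : ∀ n, 1 - q * q ^ n ≠ 0 := fun n => sub_ne_zero.mpr (by
    rw [← pow_succ']; exact (hq1 n).symm)
  have h2 : ∀ n, 1 - z ^ 2 * q ^ n ≠ 0 := fun n => sub_ne_zero.mpr (hz n).symm
  have hshift : ∀ i n, qPoch (z ^ 2 * q ^ i) q (n + 1)
      = (1 - z ^ 2 * q ^ i) * qPoch (z ^ 2 * q ^ (i + 1)) q n := fun i n => by
    rw [qPoch_succ', mul_assoc, ← pow_succ]
  induction k generalizing j with
  | zero =>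
    have e1 : qPoch (z ^ 2 * q ^ 0) q (0 + (j + 1) + 1) =
        (1 - z ^ 2) * (qPoch (z ^ 2 * q ^ 1) q j * (1 - z ^ 2 * q ^ (j + 1))) := by
      rw [hshift, zero_add, zero_add, qPoch_succ]; ring
    have e2 : qPoch (z ^ 2 * q ^ 0) q (0 + j + 1) = (1 - z ^ 2) * qPoch (z ^ 2 * q ^ 1) q j := by
      rw [hshift, zero_add, zero_add]; ring
    have e3 : qPoch (z ^ 2 * q ^ (0 + 1)) q (0 + j + 1) =
        qPoch (z ^ 2 * q ^ 1) q j * (1 - z ^ 2 * q ^ (j + 1)) := by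
      rw [zero_add, zero_add, qPoch_succ]; ring
    have e4 : qPoch q q (0 + (j + 1)) = qPoch q q j * (1 - q * q ^ j) := by
      rw [zero_add, qPoch_succ]
    have e5 : qPoch z q (0 + (j + 1) + 1) = qPoch z q (j + 1) * (1 - z * q ^ (j + 1)) := by
      rw [zero_add, qPoch_succ]
    have e6 : qPoch q q (j + 1) = qPoch q q j * (1 - q * q ^ j) := qPoch_succ ..
    have n0 : 1 - z ^ 2 ≠ 0 := by simpa using h2 0
    have n1 := h2 (j + 1)
    have n2 := hzz 1 j
    have n3 := hqq j
    have n4 := h1 j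
    simp only [quintTerm, zero_add, Finset.range_one, Finset.sum_singleton, Nat.sub_zero] at *
    rw [e1, e2, e3, e5, e6, qPoch_zero]
    field_simp
    ring
  | succ k ih =>
    rw [Finset.sum_range_succ]
    have e : ∀ i, k + 1 + j - i = k + (j + 1) - i := fun i => by omega
    simp only [e]
    rw [ih (j + 1), show k + (j + 1) - (k + 1) = j by omega]
    have e1 : qPoch (z ^ 2 * q ^ (k + 1)) q (k + (j + 1) + 1) =
        (1 - z ^ 2 * q ^ (k + 1)) * qPoch (z ^ 2 * q ^ (k + 2)) q (k + j + 1) := by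
      rw [hshift]; rfl
    have e2 : qPoch (z ^ 2 * q ^ (k + 1)) q (k + 1 + j + 1) =
        (1 - z ^ 2 * q ^ (k + 1)) * qPoch (z ^ 2 * q ^ (k + 2)) q (k + j + 1) := by
      rw [hshift, show k + 1 + j = k + j + 1 by ring]
    have e3 : qPoch (z ^ 2 * q ^ (k + 1)) q (k + 1 + (j + 1) + 1) =
        (1 - z ^ 2 * q ^ (k + 1)) * (qPoch (z ^ 2 * q ^ (k + 2)) q (k + j + 1) *
          (1 - z ^ 2 * q ^ (2 * k + j + 3))) := by
      rw [hshift, show k + 1 + (j + 1) = k + j + 1 + 1 by ring, qPoch_succ]; ring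
    have e4 : qPoch (z ^ 2 * q ^ (k + 1 + 1)) q (k + (j + 1) + 1) =
        qPoch (z ^ 2 * q ^ (k + 2)) q (k + j + 1) * (1 - z ^ 2 * q ^ (2 * k + j + 3)) := by
      rw [show k + (j + 1) + 1 = k + j + 1 + 1 by ring, qPoch_succ]; ring
    have e5 : qPoch q q (k + 1 + (j + 1)) = qPoch q q (k + j + 1) * (1 - q * q ^ (k + j + 1)) := by
      rw [show k + 1 + (j + 1) = k + j + 1 + 1 by ring, qPoch_succ]
    have e6 : qPoch z q (k + 1 + (j + 1) + 1) =
        qPoch z q (k + j + 2) * (1 - z * q ^ (k + j + 2)) := by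
      rw [show k + 1 + (j + 1) + 1 = k + j + 2 + 1 by ring, qPoch_succ]
    simp only [quintTerm]
    rw [e1, e3, show k + 1 + j = k + (j + 1) by ring, e1, e4, e5, e6, qPoch_succ q q j,
      qPoch_succ q q k, show k + (j + 1) = k + j + 1 by ring]
    have n1 := h2 (k + 1)
    have n2 := h2 (2 * k + j + 3)
    have n3 := hzz (k + 2) (k + j + 1)
    have n4 := h1 k
    have n5 := h1 j
    have n6 := hqq k
    have n7 := hqq j
    generalize qPoch (z ^ 2 * q ^ (k + 2)) q (k + j + 1) = Z at *
    generalize qPoch q q k = A at *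
    generalize qPoch q q j = B at *
    generalize qPoch q q (k + j + 1) = C at *
    generalize qPoch z q (k + j + 1 + 1) = Y at *
    field_simp
    ring

theorem sum_quintTerm {z q : K} (hq1 : ∀ n : ℕ, q ^ (n + 1) ≠ 1)
    (hz : ∀ n : ℕ, z ^ 2 * q ^ n ≠ 1) (m : ℕ) :
    ∑ i ∈ Finset.range (m + 1), quintTerm z q i (m - i) = 1 := by
  have hqq : ∀ n, qPoch q q n ≠ 0 := fun n => qPoch_ne_zero fun l _ => by
    rw [← pow_succ']; exact hq1 l
  have hzz : ∀ i n, qPoch (z ^ 2 * q ^ i) q n ≠ 0 := fun i n => qPoch_ne_zero fun l _ => by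
    rw [mul_assoc, ← pow_add]; exact hz _
  have h2 : ∀ n, 1 - z ^ 2 * q ^ n ≠ 0 := fun n => sub_ne_zero.mpr (hz n).symm
  induction m with
  | zero =>
    have n0 : 1 - z ^ 2 ≠ 0 := by simpa using h2 0
    simp [quintTerm, qPoch]
    field_simp
    ring
  | succ m ih =>
    have h := sum_quintTerm_sub hq1 hz m 0
    rw [Finset.sum_sub_distrib, add_zero, ih, sub_eq_iff_eq_add] at h
    rw [Finset.sum_range_succ, Nat.sub_self]
    have e : ∀ i ∈ Finset.range (m + 1),
        quintTerm z q i (m + 1 - i) = quintTerm z q i (m - i + 1) := by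
      intro i hi
      rw [Finset.mem_range] at hi
      rw [show m + 1 - i = m - i + 1 by omega]
    rw [Finset.sum_congr rfl e, h]
    have e1 : qPoch (z ^ 2 * q ^ (m + 1)) q (m + 1 + 1) =
      qPoch (z ^ 2 * q ^ (m + 1)) q (m + 1) * (1 - z ^ 2 * q ^ (2 * m + 2)) := by
      rw [qPoch_succ _ _ (m + 1)]; ring
    have n1 := hzz (m + 1) (m + 1)
    have n2 := h2 (2 * m + 2)
    have n3 := hqq m
    have n4 := hqq (m + 1)
    simp only [quintTerm, add_zero]
    rw [e1, qPoch_zero, qPoch_succ z q (m + 1)]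
    field_simp
    ring

end FiniteQuintuple

/-! ### The finite identity recentred to a two-sided sum. -/

section BilateralQuintuple

variable {K : Type*} [Field K]

/-- The monomial part of the `k`-th summand of the quintuple product identity, in a field. -/
def quintMono (z q : K) (k : ℤ) : K :=
  ((Int.negOnePow k : ℤ) : K) * ((1 + z * q ^ k) * z ^ (3 * k) * q ^ pentagonal k)

theorem two_mul_triangle (n : ℕ) : 2 * (n * (n + 1) / 2) = n * (n + 1) :=
  Nat.two_mul_div_two_of_even (Nat.even_mul_succ_self n)

theorem pentagonal_triangle {i j m : ℕ} (h : i + j = 2 * m) :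
    i ^ 2 + j * (j + 1) / 2 = pentagonal ((i : ℤ) - m) + m * i + m * (m + 1) / 2 := by
  have h1 := two_mul_triangle j
  have h2 := two_mul_triangle m
  have h3 := two_mul_natCast_pentagonal ((i : ℤ) - m)
  zify at *
  have hj : (j : ℤ) = 2 * m - i := by linarith
  generalize (j : ℤ) * (j + 1) / 2 = a at *
  generalize (m : ℤ) * (m + 1) / 2 = b at *
  rw [hj] at h1
  linarith

theorem neg_one_pow_eq_negOnePow_mul {i j m : ℕ} (h : i + j = 2 * m) :
    (-1 : K) ^ m = ((Int.negOnePow ((i : ℤ) - m) : ℤ) : K) * (-1) ^ j := by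
  have e : (m : ℤ) = ((i : ℤ) - m) + j := by omega
  have := congrArg (fun x : ℤˣ => ((x : ℤ) : K)) (congrArg Int.negOnePow e)
  simpa [Int.negOnePow_add] using this

/-- Replacing z by z q^{-m} at order 2m centres the sum at i = m. The Pochhammer symbols that now
start at negative powers of q are split at q^0 and their negative halves reversed by
`qPoch_reverse`; the leftover powers of q combine to the pentagonal exponent at i - m. -/
theorem quintTerm_shift {z q : K} (hz : z ≠ 0) (hq : q ≠ 0) (hq1 : ∀ n : ℕ, q ^ (n + 1) ≠ 1)
    (hzq : ∀ n : ℤ, z ^ 2 * q ^ n ≠ 1) {i j m : ℕ} (h : i + j = 2 * m) :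
    quintTerm (z * (q ^ m)⁻¹) q i j * (qPoch q q i * qPoch q q j *
      (qPoch (q * (z ^ 2)⁻¹) q j * qPoch (z ^ 2) q (i + 1))) =
    quintMono z q ((i : ℤ) - m) *
      (qPoch q q (2 * m) * qPoch (q * z⁻¹) q m * qPoch z q (m + 1)) := by
  have hqq : ∀ n, qPoch q q n ≠ 0 := fun n => qPoch_ne_zero fun l _ => by
    rw [← pow_succ']; exact hq1 l
  have hR2 : qPoch (q * (z ^ 2)⁻¹) q j ≠ 0 := qPoch_ne_zero fun l _ hl => by
    apply hzq (-(l + 1 : ℕ))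
    rw [zpow_neg, zpow_natCast, pow_succ']
    field_simp at hl ⊢
    rw [← hl, pow_succ']
  have hS2 : qPoch (z ^ 2) q (i + 1) ≠ 0 := qPoch_ne_zero fun l _ => by
    simpa using hzq l
  have e1 : qPoch (z * (q ^ m)⁻¹) q (i + j + 1) =
      qPoch (z * (q ^ m)⁻¹) q m * qPoch z q (m + 1) := by
    rw [h, show 2 * m + 1 = m + (m + 1) by ring, qPoch_add]
    congr 2
    field_simp
  have e2 : qPoch ((z * (q ^ m)⁻¹) ^ 2 * q ^ i) q (i + j + 1) =
      qPoch (z ^ 2 * (q ^ j)⁻¹) q j * qPoch (z ^ 2) q (i + 1) := by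
    have : (z * (q ^ m)⁻¹) ^ 2 * q ^ i = z ^ 2 * (q ^ j)⁻¹ := by
      have : q ^ i * q ^ j = (q ^ m) ^ 2 := by rw [← pow_add, h]; ring
      field_simp
      linear_combination this
    rw [this, show i + j + 1 = j + (i + 1) by ring, qPoch_add]
    congr 2
    field_simp
  have r1 := qPoch_reverse hz hq m
  have r2 := qPoch_reverse (pow_ne_zero 2 hz) hq j
  have s1 := neg_one_pow_eq_negOnePow_mul (K := K) h
  have s2 : z ^ i * z ^ m = z ^ (3 * ((i : ℤ) - m)) * z ^ (2 * j) := by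
    rw [← zpow_natCast, ← zpow_natCast, ← zpow_natCast, ← zpow_add₀ hz, ← zpow_add₀ hz]
    congr 1
    push_cast
    omega
  have s3 : q ^ (i ^ 2) * q ^ (j * (j + 1) / 2) =
      q ^ pentagonal ((i : ℤ) - m) * (q ^ m) ^ i * q ^ (m * (m + 1) / 2) := by
    rw [← pow_add, pentagonal_triangle h, pow_add, pow_add, pow_mul]
  have s4 : z * (q ^ m)⁻¹ * q ^ i = z * q ^ ((i : ℤ) - m) := by
    rw [zpow_sub₀ hq, zpow_natCast, zpow_natCast]
    field_simp
  have hne2 : qPoch (z ^ 2 * (q ^ j)⁻¹) q j ≠ 0 := by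
    intro h0
    rw [h0, zero_mul] at r2
    exact mul_ne_zero (pow_ne_zero _ (neg_ne_zero.mpr (pow_ne_zero 2 hz))) hR2 r2.symm
  rw [quintTerm, quintMono, e1, e2, s4, h]
  rw [neg_pow, s1] at r1
  rw [neg_pow, ← pow_mul] at r2
  have n1 := hqq i
  have n2 := hqq j
  have n3 : q ^ (m * (m + 1) / 2) ≠ 0 := pow_ne_zero _ hq
  have n4 : q ^ (j * (j + 1) / 2) ≠ 0 := pow_ne_zero _ hq
  have n5 : q ^ m ≠ 0 := pow_ne_zero _ hq
  have n6 : z ^ (2 * j) ≠ 0 := pow_ne_zero _ hz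
  have n7 : z ^ m ≠ 0 := pow_ne_zero _ hz
  have n8 : (-1 : K) ^ j ≠ 0 := pow_ne_zero _ (by simp)
  rw [mul_pow, inv_pow]
  generalize qPoch (z * (q ^ m)⁻¹) q m = L1 at *
  generalize qPoch (z ^ 2 * (q ^ j)⁻¹) q j = L2 at *
  generalize qPoch (q * (z ^ 2)⁻¹) q j = R2 at *
  generalize qPoch (q * z⁻¹) q m = R1 at *
  generalize ((Int.negOnePow ((i : ℤ) - m) : ℤ) : K) = s at *
  generalize (-1 : K) ^ j = sj at *
  generalize z ^ (3 * ((i : ℤ) - m)) = w at *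
  generalize z * q ^ ((i : ℤ) - m) = y at *
  generalize q ^ (m * (m + 1) / 2) = a at *
  generalize q ^ (j * (j + 1) / 2) = b at *
  generalize q ^ (i ^ 2) = c at *
  generalize q ^ pentagonal ((i : ℤ) - m) = d at *
  have n9 : (q ^ m) ^ i ≠ 0 := pow_ne_zero _ n5
  generalize (q ^ m) ^ i = f at *
  generalize z ^ (2 * j) = g at *
  generalize qPoch (z ^ 2) q (i + 1) = S2 at *
  generalize qPoch z q (m + 1) = S1 at *
  generalize z ^ i = h1 at *
  generalize z ^ m = h2 at *
  have hL1 : L1 = s * sj * h2 * R1 / a := by rw [eq_div_iff n3]; exact r1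
  have hL2 : L2 = sj * g * R2 / b := by rw [eq_div_iff n4]; exact r2
  have hc : c = d * f * a / b := by rw [eq_div_iff n4]; exact s3
  have hh : h1 = w * g / h2 := by rw [eq_div_iff n7]; exact s2
  rw [hL1, hL2, hc, hh]
  field_simp

/-- A finite form of the quintuple product identity, with cleared denominators. -/
theorem sum_quintMono {z q : K} (hz : z ≠ 0) (hq : q ≠ 0) (hq1 : ∀ n : ℕ, q ^ (n + 1) ≠ 1)
    (hzq : ∀ n : ℤ, z ^ 2 * q ^ n ≠ 1) (m : ℕ) :
    (∑ i ∈ Finset.range (2 * m + 1), quintMono z q ((i : ℤ) - m) *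
      ((∏ l ∈ Finset.Ico i (2 * m), (1 - q * q ^ l)) *
      (∏ l ∈ Finset.Ico (2 * m - i) (2 * m), (1 - q * q ^ l)) *
      (∏ l ∈ Finset.Ico (2 * m - i) (2 * m), (1 - q * (z ^ 2)⁻¹ * q ^ l)) *
      ∏ l ∈ Finset.Ico (i + 1) (2 * m + 1), (1 - z ^ 2 * q ^ l))) *
      (qPoch (q * z⁻¹) q m * qPoch z q (m + 1)) =
    qPoch q q (2 * m) * qPoch (q * (z ^ 2)⁻¹) q (2 * m) * qPoch (z ^ 2) q (2 * m + 1) := by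
  have hqq : ∀ n, qPoch q q n ≠ 0 := fun n => qPoch_ne_zero fun l _ => by
    rw [← pow_succ']; exact hq1 l
  have key := sum_quintTerm (z := z * (q ^ m)⁻¹) hq1 (fun n h => hzq (n - 2 * m) (by
    rw [← h, zpow_sub₀ hq, zpow_natCast, mul_comm 2, zpow_mul, zpow_natCast]
    field_simp)) (2 * m)
  -- The extra factor is the (q;q)_{2m} on the right of `quintTerm_shift`; the products over
  -- `Finset.Ico` are the complements that bring all denominators to a common one.
  apply mul_left_cancel₀ (hqq (2 * m))
  rw [mul_left_comm, Finset.sum_mul]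
  have split : ∀ (a : K) {i n : ℕ}, i ≤ n →
      qPoch a q n = qPoch a q i * ∏ l ∈ Finset.Ico i n, (1 - a * q ^ l) :=
    fun a i n hin => (Finset.prod_range_mul_prod_Ico _ hin).symm
  calc _ = ∑ i ∈ Finset.range (2 * m + 1), quintTerm (z * (q ^ m)⁻¹) q i (2 * m - i) *
        (qPoch q q (2 * m) * (qPoch q q (2 * m) * qPoch (q * (z ^ 2)⁻¹) q (2 * m) *
          qPoch (z ^ 2) q (2 * m + 1))) := by
        refine Finset.sum_congr rfl fun i hi => ?_
        rw [Finset.mem_range, Nat.lt_succ_iff] at hi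
        have sh := quintTerm_shift hz hq hq1 hzq (Nat.add_sub_cancel' hi)
        have a1 := split q hi
        have a2 := split q (Nat.sub_le (2 * m) i)
        have a3 := split (q * (z ^ 2)⁻¹) (Nat.sub_le (2 * m) i)
        have a4 := split (z ^ 2) (Nat.succ_le_succ hi)
        generalize ∏ l ∈ Finset.Ico i (2 * m), (1 - q * q ^ l) = t1 at *
        generalize ∏ l ∈ Finset.Ico (2 * m - i) (2 * m), (1 - q * q ^ l) = t2 at *
        generalize ∏ l ∈ Finset.Ico (2 * m - i) (2 * m), (1 - q * (z ^ 2)⁻¹ * q ^ l) = t3 at *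
        generalize ∏ l ∈ Finset.Ico (i + 1) (2 * m + 1), (1 - z ^ 2 * q ^ l) = t4 at *
        have e : qPoch q q (2 * m) * (qPoch q q (2 * m) * qPoch (q * (z ^ 2)⁻¹) q (2 * m) *
            qPoch (z ^ 2) q (2 * m + 1)) = (qPoch q q i * t1) * ((qPoch q q (2 * m - i) * t2) *
            (qPoch (q * (z ^ 2)⁻¹) q (2 * m - i) * t3) * (qPoch (z ^ 2) q (i + 1) * t4)) := by
          rw [← a1, ← a2, ← a3]
          congr 2
        rw [e]
        linear_combination (-(t1 * t2 * t3 * t4)) * sh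
    _ = _ := by rw [← Finset.sum_mul, key, one_mul]

end BilateralQuintuple

/-! ### The quintuple product identity for formal power series. -/

open PowerSeries Filter Topology

/-- The exponent `3 u k + v k (3 k - 1) / 2` in the quintuple product series. -/
def quintExpA (u v : ℕ) (k : ℤ) : ℕ := (3 * u * k + v * pentagonal k).toNat

/-- The exponent `3 u k + v k (3 k - 1) / 2 + u + v k` in the quintuple product series. -/
def quintExpB (u v : ℕ) (k : ℤ) : ℕ := (3 * u * k + v * pentagonal k + u + v * k).toNat

/-- The bound serves twice: it makes `toNat` in the exponent harmless, and it makes the bilateral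
series summable. -/
theorem abs_le_expA {u v : ℕ} (huv : 2 * u < v) (k : ℤ) :
    |k| ≤ 3 * u * k + v * pentagonal k := by
  have h := two_mul_natCast_pentagonal k
  have huv' : 2 * (u : ℤ) + 1 ≤ v := by exact_mod_cast huv
  have hu : (0 : ℤ) ≤ u := by positivity
  obtain hk | hk := lt_or_ge 0 k
  · rw [abs_of_pos hk]
    nlinarith [mul_nonneg hu hk.le, mul_nonneg hk.le hk.le, mul_pos hk hk,
      mul_nonneg (mul_nonneg hk.le (by linarith : (0:ℤ) ≤ k - 1)) (by linarith : (0:ℤ) ≤ v),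
      mul_nonneg hk.le (by linarith : (0 : ℤ) ≤ v - 2 * u - 1)]
  · rw [abs_of_nonpos hk]
    obtain rfl | hk' := eq_or_lt_of_le hk
    · simp [pentagonal]
    · obtain ⟨j, rfl⟩ : ∃ j, k = -j := ⟨-k, by simp⟩
      have hj : 0 ≤ j - 1 := by linarith
      have hv : (0 : ℤ) ≤ v - 2 * u - 1 := by linarith
      nlinarith [mul_nonneg hj hv, mul_nonneg hj hj, mul_nonneg (mul_nonneg hj hj) hv,
        mul_nonneg hu hj,
        mul_nonneg (mul_nonneg hj hj) hu]

theorem abs_le_expB {u v : ℕ} (huv : 2 * u < v) (k : ℤ) :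
    |k| ≤ 3 * u * k + v * pentagonal k + u + v * k := by
  have h := two_mul_natCast_pentagonal k
  have huv' : 2 * (u : ℤ) + 1 ≤ v := by exact_mod_cast huv
  have hu : (0 : ℤ) ≤ u := by positivity
  have hv : (0 : ℤ) ≤ v - 2 * u - 1 := by linarith
  obtain hk | hk := le_or_gt 0 k
  · rw [abs_of_nonneg hk]
    nlinarith [mul_nonneg hu hk, mul_nonneg hk hv, mul_nonneg (mul_nonneg hk hk) hv,
      mul_nonneg (mul_nonneg hk hk) hu]
  · rw [abs_of_neg hk]
    obtain ⟨j, rfl⟩ : ∃ j, k = -j := ⟨-k, by simp⟩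
    have hj : 0 ≤ j - 1 := by linarith
    nlinarith [mul_nonneg hj hv, mul_nonneg hj hj, mul_nonneg (mul_nonneg hj hj) hv,
        mul_nonneg hu hj,
        mul_nonneg (mul_nonneg hj hj) hu]

theorem natCast_quintExpA {u v : ℕ} (huv : 2 * u < v) (k : ℤ) :
    (quintExpA u v k : ℤ) = 3 * u * k + v * pentagonal k :=
  Int.toNat_of_nonneg ((abs_nonneg k).trans (abs_le_expA huv k))

theorem natCast_quintExpB {u v : ℕ} (huv : 2 * u < v) (k : ℤ) :
    (quintExpB u v k : ℤ) = 3 * u * k + v * pentagonal k + u + v * k :=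
  Int.toNat_of_nonneg ((abs_nonneg k).trans (abs_le_expB huv k))

/-- The `k`-th summand of the quintuple product series. -/
noncomputable def quintSummand (u v : ℕ) (k : ℤ) : ℤ⟦X⟧ :=
  (Int.negOnePow k : ℤ⟦X⟧) * (X ^ quintExpA u v k + X ^ quintExpB u v k)

theorem X_pow_dvd_quintSummand {u v : ℕ} (huv : 2 * u < v) (k : ℤ) :
    (X : ℤ⟦X⟧) ^ k.natAbs ∣ quintSummand u v k := by
  refine Dvd.dvd.mul_left (dvd_add (pow_dvd_pow _ ?_) (pow_dvd_pow _ ?_)) _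
  · have := abs_le_expA huv k
    rw [← natCast_quintExpA huv, Int.abs_eq_natAbs] at this
    exact_mod_cast this
  · have := abs_le_expB huv k
    rw [← natCast_quintExpB huv, Int.abs_eq_natAbs] at this
    exact_mod_cast this

theorem coeff_eq_zero_of_X_pow_dvd {n d : ℕ} {f : ℤ⟦X⟧} (h : X ^ n ∣ f) (hd : d < n) :
    coeff d f = 0 := X_pow_dvd_iff.mp h d hd

theorem summable_of_X_pow_natAbs_dvd {f : ℤ → ℤ⟦X⟧} (h : ∀ k, X ^ k.natAbs ∣ f k) :
    Summable f := by
  rw [WithPiTopology.summable_iff_summable_coeff]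
  intro d
  refine summable_of_hasFiniteSupport ((Set.finite_Icc (-(d : ℤ)) d).subset fun k hk => ?_)
  by_contra hk'
  apply hk
  refine coeff_eq_zero_of_X_pow_dvd (h k) ?_
  rw [Set.mem_Icc] at hk'
  omega

/-- The quintuple product series. -/
noncomputable def quintSeries (u v : ℕ) : ℤ⟦X⟧ := ∑' k, quintSummand u v k

theorem hasSum_quintSeries {u v : ℕ} (huv : 2 * u < v) :
    HasSum (quintSummand u v) (quintSeries u v) :=
  (summable_of_X_pow_natAbs_dvd (X_pow_dvd_quintSummand huv)).hasSum

/-- The infinite product `∏ (1 - X ^ (e + f k))`. -/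
noncomputable def progProd (e f : ℕ) : ℤ⟦X⟧ := ∏' k : ℕ, (1 - X ^ (e + f * k))

theorem multipliable_progProd {e f : ℕ} (hf : 0 < f) :
    Multipliable fun k : ℕ => (1 - (X : ℤ⟦X⟧) ^ (e + f * k)) := by
  simp_rw [sub_eq_add_neg]
  apply WithPiTopology.multipliable_one_add_of_tendsto_order_atTop_nhds_top
  simp_rw [order_neg, order_X_pow]
  refine ENat.tendsto_nhds_top_iff_natCast_lt.mpr fun n => ?_
  filter_upwards [eventually_gt_atTop n] with k hk
  exact_mod_cast (by nlinarith : n < e + f * k)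

theorem tendsto_progProd {e f : ℕ} (hf : 0 < f) :
    Tendsto (fun n => ∏ l ∈ Finset.range n, (1 - (X : ℤ⟦X⟧) ^ (e + f * l))) atTop
      (𝓝 (progProd e f)) :=
  (multipliable_progProd hf).hasProd.tendsto_prod_nat

theorem finite_quintuple {u v : ℕ} (hu : 0 < u) (huv : 2 * u < v) (m : ℕ) :
    (∑ i ∈ Finset.range (2 * m + 1), quintSummand u v ((i : ℤ) - m) *
      ((∏ l ∈ Finset.Ico i (2 * m), (1 - X ^ (v + v * l))) *
      (∏ l ∈ Finset.Ico (2 * m - i) (2 * m), (1 - X ^ (v + v * l))) *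
      (∏ l ∈ Finset.Ico (2 * m - i) (2 * m), (1 - X ^ (v - 2 * u + v * l))) *
      ∏ l ∈ Finset.Ico (i + 1) (2 * m + 1), (1 - X ^ (2 * u + v * l)))) *
      ((∏ l ∈ Finset.range m, (1 - X ^ (v - u + v * l))) *
        ∏ l ∈ Finset.range (m + 1), (1 - X ^ (u + v * l))) =
    (∏ l ∈ Finset.range (2 * m), (1 - X ^ (v + v * l))) *
      (∏ l ∈ Finset.range (2 * m), (1 - X ^ (v - 2 * u + v * l))) *
      ∏ l ∈ Finset.range (2 * m + 1), (1 - (X : ℤ⟦X⟧) ^ (2 * u + v * l)) := by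
  set φ := algebraMap ℤ⟦X⟧ (FractionRing ℤ⟦X⟧) with hφ
  have hinj : Function.Injective φ := IsFractionRing.injective _ _
  apply hinj
  set x := φ X with hx
  have hx0 : x ≠ 0 := (map_ne_zero_iff φ hinj).mpr X_ne_zero
  have hx1 : ∀ n : ℕ, 0 < n → x ^ n ≠ 1 := fun n hn h => by
    rw [hx, ← map_pow, ← map_one φ] at h
    have := congrArg constantCoeff (hinj h)
    simp [hn.ne'] at this
  have hx1' : ∀ n : ℤ, n ≠ 0 → x ^ n ≠ 1 := fun n hn h => by
    obtain ⟨k, rfl | rfl⟩ := n.eq_nat_or_neg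
    · exact hx1 k (by omega) (by simpa using h)
    · exact hx1 k (by omega) (by simpa using h)
  have key := sum_quintMono (z := x ^ u) (q := x ^ v) (pow_ne_zero _ hx0) (pow_ne_zero _ hx0)
    (fun n => by rw [← pow_mul]; exact hx1 _ (Nat.mul_pos (by omega) n.succ_pos))
    -- An equality z² qⁿ = 1 would force v to divide 2u, impossible for 0 < 2u < v.
    (fun n => by
      rw [← pow_mul, ← zpow_natCast, ← zpow_natCast, ← zpow_mul, ← zpow_add₀ hx0]
      apply hx1'
      intro h
      push_cast at h
      have h1 : (u : ℤ) * 2 = v * (-n) := by linarith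
      have h2 : (v : ℤ) ∣ 2 * u := ⟨-n, by linarith⟩
      have := Int.le_of_dvd (by positivity) h2
      omega) m
  have f1 : ∀ l, x ^ v * (x ^ v) ^ l = φ (X ^ (v + v * l)) := fun l => by
    rw [map_pow, pow_add, pow_mul]
  have f2 : ∀ l, x ^ v * ((x ^ u) ^ 2)⁻¹ * (x ^ v) ^ l = φ (X ^ (v - 2 * u + v * l)) := fun l => by
    rw [map_pow, pow_add, pow_mul, pow_sub₀ _ hx0 huv.le, ← pow_mul, mul_comm u]
  have f3 : ∀ l, x ^ v * (x ^ u)⁻¹ * (x ^ v) ^ l = φ (X ^ (v - u + v * l)) := fun l => by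
    rw [map_pow, pow_add, pow_mul, pow_sub₀ _ hx0 (by omega)]
  have f4 : ∀ l, (x ^ u) ^ 2 * (x ^ v) ^ l = φ (X ^ (2 * u + v * l)) := fun l => by
    rw [map_pow, ← hx, pow_add, ← pow_mul, ← pow_mul, mul_comm u]
  have f5 : ∀ l, x ^ u * (x ^ v) ^ l = φ (X ^ (u + v * l)) := fun l => by
    rw [map_pow, pow_add, pow_mul]
  have f6 : ∀ k, quintMono (x ^ u) (x ^ v) k = φ (quintSummand u v k) := fun k => by
    rw [quintMono, quintSummand, map_mul, map_add, map_pow, map_pow, map_intCast, ← hx]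
    have hA := natCast_quintExpA huv k
    have hB := natCast_quintExpB huv k
    rw [← zpow_natCast x (quintExpA u v k), ← zpow_natCast x (quintExpB u v k), hA, hB]
    simp only [← zpow_natCast, ← zpow_mul]
    rw [mul_assoc (1 + _), add_mul, ← zpow_add₀ hx0, one_mul, ← zpow_add₀ hx0, ← zpow_add₀ hx0]
    congr 3 <;> ring_nf
  simp only [qPoch, f1, f2, f3, f4, f5, f6] at key
  simpa only [map_mul, map_sum, map_prod, map_sub, map_one] using key

theorem X_pow_dvd_mul_sub_one {a : ℕ} {g h : ℤ⟦X⟧} (hg : X ^ a ∣ g - 1) (hh : X ^ a ∣ h - 1) :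
    X ^ a ∣ g * h - 1 := by
  have : g * h - 1 = (g - 1) * h + (h - 1) := by ring
  rw [this]
  exact dvd_add (hg.mul_right _) hh

theorem X_pow_dvd_prod_sub_one {a b c e f : ℕ} (h : ∀ l, b ≤ l → a ≤ e + f * l) :
    (X : ℤ⟦X⟧) ^ a ∣ (∏ l ∈ Finset.Ico b c, (1 - X ^ (e + f * l))) - 1 := by
  refine Finset.prod_induction _ (fun g : ℤ⟦X⟧ => X ^ a ∣ g - 1)
    (fun _ _ => X_pow_dvd_mul_sub_one) (by simp) fun l hl => ?_
  rw [sub_sub_cancel_left, dvd_neg]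
  exact pow_dvd_pow _ (h l (Finset.mem_Ico.mp hl).1)

theorem tendsto_of_X_pow_dvd_sub {F G : ℕ → ℤ⟦X⟧} {L : ℤ⟦X⟧} (hG : Tendsto G atTop (𝓝 L))
    (h : ∀ m, X ^ m ∣ F m - G m) : Tendsto F atTop (𝓝 L) := by
  rw [WithPiTopology.tendsto_iff_coeff_tendsto] at hG ⊢
  intro d
  refine (hG d).congr' ?_
  filter_upwards [eventually_gt_atTop d] with m hm
  have := coeff_eq_zero_of_X_pow_dvd (h m) hm
  rw [map_sub, sub_eq_zero] at this
  exact this.symm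

theorem sum_range_int_shift {M : Type*} [AddCommMonoid M] (f : ℤ → M) (m : ℕ) :
    ∑ i ∈ Finset.range (2 * m + 1), f ((i : ℤ) - m) = ∑ k ∈ Finset.Icc (-(m : ℤ)) m, f k := by
  refine Finset.sum_bij (fun i _ => (i : ℤ) - m) ?_ ?_ ?_ fun _ _ => rfl
  · intro i hi
    rw [Finset.mem_range] at hi
    rw [Finset.mem_Icc]
    omega
  · intro i _ j _ h
    omega
  · intro k hk
    rw [Finset.mem_Icc] at hk
    exact ⟨(k + m).toNat, Finset.mem_range.mpr (by omega), by omega⟩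

/-- The **quintuple product identity**, specialized to powers of a formal variable. -/
theorem quintSeries_mul {u v : ℕ} (hu : 0 < u) (huv : 2 * u < v) :
    quintSeries u v * (progProd (v - u) v * progProd u v) =
      progProd v v * progProd (v - 2 * u) v * progProd (2 * u) v := by
  have hv : 0 < v := by omega
  have hv1 : ∀ l, l ≤ v * l := fun l => Nat.le_mul_of_pos_left l hv
  have t2 : Tendsto (fun m : ℕ => 2 * m) atTop atTop :=
    tendsto_id.const_mul_atTop' (by norm_num)
  have t1 : Tendsto (fun m : ℕ => m + 1) atTop atTop := tendsto_add_atTop_nat 1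
  have hR := (((tendsto_progProd (e := v) hv).comp t2).mul
    ((tendsto_progProd (e := v - 2 * u) hv).comp t2)).mul
    ((tendsto_progProd (e := 2 * u) hv).comp (t1.comp t2))
  have hC := (tendsto_progProd (e := v - u) hv).mul ((tendsto_progProd (e := u) hv).comp t1)
  have hS : Tendsto (fun m : ℕ => ∑ i ∈ Finset.range (2 * m + 1), quintSummand u v ((i : ℤ) - m))
      atTop (𝓝 (quintSeries u v)) := by
    simp_rw [sum_range_int_shift]
    exact (hasSum_quintSeries huv).comp Finset.tendsto_Icc_neg
  have hL := (tendsto_of_X_pow_dvd_sub (F := fun m => ∑ i ∈ Finset.range (2 * m + 1),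
      quintSummand u v ((i : ℤ) - m) *
      ((∏ l ∈ Finset.Ico i (2 * m), (1 - X ^ (v + v * l))) *
      (∏ l ∈ Finset.Ico (2 * m - i) (2 * m), (1 - X ^ (v + v * l))) *
      (∏ l ∈ Finset.Ico (2 * m - i) (2 * m), (1 - X ^ (v - 2 * u + v * l))) *
      ∏ l ∈ Finset.Ico (i + 1) (2 * m + 1), (1 - X ^ (2 * u + v * l)))) hS ?_).mul hC
  · refine tendsto_nhds_unique (hL.congr fun m => ?_) hR
    exact finite_quintuple hu huv m
  · intro m
    rw [← Finset.sum_sub_distrib]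
    refine Finset.dvd_sum fun i hi => ?_
    rw [Finset.mem_range] at hi
    rw [← mul_sub_one]
    set k : ℤ := (i : ℤ) - m with hk
    -- The summand is divisible by X^|k|, while its tail products start at l ≥ m - |k| and so are 1
    -- modulo X^(m - |k|). Together each correction vanishes modulo X^m.
    refine (pow_dvd_pow X (by omega : m ≤ k.natAbs + (m - k.natAbs))).trans ?_
    rw [pow_add]
    refine mul_dvd_mul (X_pow_dvd_quintSummand huv k) ?_
    refine X_pow_dvd_mul_sub_one (X_pow_dvd_mul_sub_one (X_pow_dvd_mul_sub_one ?_ ?_) ?_) ?_ <;>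
      refine X_pow_dvd_prod_sub_one fun l hl => ?_ <;> have := hv1 l <;> omega

/-! ### Positivity of coefficients of infinite products. -/

/-- A power series with an inverse all of whose coefficients are nonnegative. -/
def HasNonnegInv (f : ℤ⟦X⟧) : Prop := ∃ g : ℤ⟦X⟧, f * g = 1 ∧ ∀ n, 0 ≤ coeff n g

theorem coeff_mul_nonneg {f g : ℤ⟦X⟧} (hf : ∀ n, 0 ≤ coeff n f) (hg : ∀ n, 0 ≤ coeff n g) (n : ℕ) :
    0 ≤ coeff n (f * g) := by
  rw [coeff_mul]
  exact Finset.sum_nonneg fun x _ => mul_nonneg (hf _) (hg _)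

theorem coeff_one_nonneg (n : ℕ) : 0 ≤ coeff n (1 : ℤ⟦X⟧) := by
  rw [coeff_one]; split_ifs <;> simp

theorem HasNonnegInv.mul {f g : ℤ⟦X⟧} (hf : HasNonnegInv f) (hg : HasNonnegInv g) :
    HasNonnegInv (f * g) := by
  obtain ⟨f', hf, hf'⟩ := hf
  obtain ⟨g', hg, hg'⟩ := hg
  refine ⟨f' * g', ?_, coeff_mul_nonneg hf' hg'⟩
  rw [mul_mul_mul_comm, hf, hg, one_mul]

theorem hasNonnegInv_one_sub_X_pow {n : ℕ} (hn : n ≠ 0) : HasNonnegInv (1 - X ^ n) := by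
  refine ⟨expand n hn (mk 1), ?_, fun k => ?_⟩
  · have := congrArg (expand n hn) (mk_one_mul_one_sub_eq_one ℤ)
    rwa [map_mul, map_sub, map_one, expand_X, mul_comm] at this
  · rw [coeff_expand]
    split_ifs <;> simp

theorem multipliable_of_X_pow_dvd_sub_one {f : ℕ → ℤ⟦X⟧} (h : ∀ n, X ^ n ∣ f n - 1) :
    Multipliable f := by
  have := WithPiTopology.multipliable_one_add_of_tendsto_order_atTop_nhds_top ℤ
    (f := fun n => f n - 1) ?_
  · simpa using this
  · refine ENat.tendsto_nhds_top_iff_natCast_lt.mpr fun n => ?_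
    filter_upwards [eventually_gt_atTop n] with k hk
    exact lt_of_lt_of_le (Nat.cast_lt.mpr hk)
      (nat_le_order _ k fun i hi => coeff_eq_zero_of_X_pow_dvd (h k) hi)

/-- The product of the inverses converges because g - 1 = -(f - 1) g, and its coefficients are
limits of nonnegative ones. -/
theorem HasNonnegInv.tprod {f : ℕ → ℤ⟦X⟧} (h : ∀ n, X ^ n ∣ f n - 1)
    (hf : ∀ n, HasNonnegInv (f n)) : HasNonnegInv (∏' n, f n) := by
  choose g hg hg' using hf
  have hgm : Multipliable g := multipliable_of_X_pow_dvd_sub_one fun n => by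
    have : g n - 1 = -((f n - 1) * g n) := by rw [sub_mul, hg]; ring
    rw [this]
    exact ((h n).mul_right _).neg_right
  refine ⟨∏' n, g n, ?_, fun n => ?_⟩
  · rw [← (multipliable_of_X_pow_dvd_sub_one h).tprod_mul hgm]
    simp [hg]
  · have ht := ((WithPiTopology.continuous_coeff ℤ n).tendsto _).comp
      hgm.hasProd.tendsto_prod_nat
    refine ge_of_tendsto' ht fun m => ?_
    exact Finset.prod_induction _ (fun f : ℤ⟦X⟧ => ∀ n, 0 ≤ coeff n f)
      (fun _ _ => coeff_mul_nonneg) coeff_one_nonneg (fun k _ => hg' k) n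

open Classical in
/-- The product of the factors `1 - X ^ n` over `n ∈ S`. -/
noncomputable def setProd (S : Set ℕ) : ℤ⟦X⟧ := ∏' n : ℕ, if n ∈ S then 1 - X ^ n else 1

theorem X_pow_dvd_factor_sub_one (n : ℕ) (P : Prop) [Decidable P] :
    (X : ℤ⟦X⟧) ^ n ∣ (if P then 1 - X ^ n else 1) - 1 := by
  split_ifs <;> simp

theorem hasNonnegInv_setProd {S : Set ℕ} (hS : 0 ∉ S) : HasNonnegInv (setProd S) := by
  classical
  refine HasNonnegInv.tprod (fun n => X_pow_dvd_factor_sub_one n _) fun n => ?_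
  split_ifs with h
  · exact hasNonnegInv_one_sub_X_pow fun h0 => hS (h0 ▸ h)
  · exact ⟨1, by simp, coeff_one_nonneg⟩

theorem setProd_union {S T : Set ℕ} (h : Disjoint S T) :
    setProd (S ∪ T) = setProd S * setProd T := by
  classical
  unfold setProd
  rw [← Multipliable.tprod_mul
    (multipliable_of_X_pow_dvd_sub_one fun n => X_pow_dvd_factor_sub_one n _)
    (multipliable_of_X_pow_dvd_sub_one fun n => X_pow_dvd_factor_sub_one n _)]
  refine tprod_congr fun n => ?_
  have := fun h1 : n ∈ S => Set.disjoint_left.mp h h1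
  by_cases h1 : n ∈ S <;> by_cases h2 : n ∈ T <;> simp_all

theorem setProd_singleton (n : ℕ) : setProd {n} = 1 - X ^ n := by
  classical
  unfold setProd
  rw [tprod_eq_mulSingle n]
  · simp
  · intro k hk
    simp [hk]

theorem progProd_eq_setProd {e f : ℕ} (hf : 0 < f) :
    progProd e f = setProd (Set.range fun k => e + f * k) := by
  classical
  have hinj : Function.Injective fun k => e + f * k := fun a b h => by
    simpa [hf.ne'] using h
  refine Eq.trans (tprod_congr fun k => ?_) (hinj.tprod_eq
    (f := fun n => if n ∈ Set.range (fun k => e + f * k) then 1 - (X : ℤ⟦X⟧) ^ n else 1) ?_)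
  · rw [if_pos (Set.mem_range_self k)]
  · intro n hn
    by_contra h
    exact hn (if_neg h)

/-- The factors indexed by S cancel against (q;q)_∞. As 1 ∉ S, what remains is 1/(1 - X) times a
series g with nonnegative coefficients, so each coefficient of b is a partial sum of those of g and
is at least the positive constant term of g. -/
theorem coeff_pos_of_mul_eq_setProd {b F : ℤ⟦X⟧} {S : Set ℕ} (h0 : 0 ∉ S) (h1 : 1 ∉ S)
    (hF : HasNonnegInv F) (h : b * progProd 1 1 * F = setProd S) (n : ℕ) : 0 < coeff n b := by
  set T : Set ℕ := {n | n ∉ S ∧ 2 ≤ n} with hT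
  have hU : (Set.range fun k => 1 + 1 * k) = S ∪ ({1} ∪ T) := by
    ext k
    simp only [Set.mem_range, Set.mem_union, Set.mem_singleton_iff, hT, Set.mem_ofPred_eq]
    constructor
    · rintro ⟨j, rfl⟩
      by_cases hj : 1 + 1 * j ∈ S
      · exact Or.inl hj
      · right
        rcases Nat.eq_zero_or_pos j with rfl | hj0
        · left; simp
        · right; exact ⟨hj, by omega⟩
    · intro hk
      have : k ≠ 0 := by
        rintro rfl
        rcases hk with hk | hk | hk
        · exact h0 hk
        · omega
        · omega
      exact ⟨k - 1, by omega⟩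
  have hd1 : Disjoint S ({1} ∪ T) := by
    rw [Set.disjoint_left]
    rintro k hk (rfl | hk')
    · exact h1 hk
    · exact hk'.1 hk
  have hd2 : Disjoint {1} T := by
    rw [Set.disjoint_left]
    rintro k rfl hk'
    exact absurd hk'.2 (by norm_num)
  rw [progProd_eq_setProd one_pos, hU, setProd_union hd1, setProd_union hd2, setProd_singleton,
    pow_one] at h
  obtain ⟨s, hs, -⟩ := hasNonnegInv_setProd h0
  have hT0 : 0 ∉ T := fun h => absurd h.2 (by norm_num)
  obtain ⟨g, hg, hg'⟩ := (hasNonnegInv_setProd hT0).mul hF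
  have hb : b = mk 1 * g := by
    have e1 : b * (1 - X) * (setProd T * F) = 1 := by
      linear_combination s * h + (1 - b * (1 - X) * (setProd T * F)) * hs
    have e2 := mk_one_mul_one_sub_eq_one ℤ
    linear_combination (mk 1 * g) * e1 - (b * (1 - X) * mk 1) * hg - b * e2
  have hg0 : 0 < coeff 0 g := by
    refine lt_of_le_of_ne (hg' 0) fun h => ?_
    have := congrArg constantCoeff hg
    rw [coeff_zero_eq_constantCoeff] at h
    simp [← h] at this
  rw [hb, coeff_mul]
  refine Finset.sum_pos' (fun x _ => by simpa using hg' _) ⟨(n, 0), by simp, by simpa using hg0⟩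

theorem coeff_pos_of_mul_eq_progProd {b : ℤ⟦X⟧} {v : ℕ} (hv : 1 < v)
    (h : b * progProd 1 1 = progProd v v) (n : ℕ) : 0 < coeff n b := by
  rw [progProd_eq_setProd (e := v) (f := v) (by omega)] at h
  refine coeff_pos_of_mul_eq_setProd (F := 1) ?_ ?_ ⟨1, by simp, coeff_one_nonneg⟩
    (by rw [mul_one]; exact h) n
  · rintro ⟨k, hk⟩
    dsimp only at hk
    omega
  · rintro ⟨k, hk⟩
    dsimp only at hk
    omega

/-- The numerator exponents in the quintuple product run over the progressions of v, v - 2u and 2u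
modulo v. They are disjoint because 0 < 2u < v and 4u ≠ v, and they miss 1 because v - 2u ≥ 2. -/
theorem coeff_pos_of_mul_eq_quintSeries {b : ℤ⟦X⟧} {u v : ℕ} (hu : 0 < u) (huv : 2 * u + 1 < v)
    (h4 : 4 * u ≠ v) (h : b * progProd 1 1 = quintSeries u v) (n : ℕ) : 0 < coeff n b := by
  have hv : 0 < v := by omega
  have key := quintSeries_mul hu (by omega : 2 * u < v)
  rw [← h] at key
  have hF : HasNonnegInv (progProd (v - u) v * progProd u v) := by
    rw [progProd_eq_setProd hv, progProd_eq_setProd hv]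
    refine (hasNonnegInv_setProd ?_).mul (hasNonnegInv_setProd ?_) <;>
    · rintro ⟨k, hk⟩
      dsimp only at hk
      omega
  have hsep : ∀ a b x y : ℕ, a < b → b < a + v → a + v * x ≠ b + v * y := by
    intro a b x y hab hba hxy
    rcases lt_or_ge y x with hlt | hge
    · have := Nat.mul_le_mul_left v (Nat.succ_le_of_lt hlt)
      rw [Nat.mul_succ] at this
      omega
    · have := Nat.mul_le_mul_left v hge
      omega
  rw [progProd_eq_setProd hv (e := v), progProd_eq_setProd hv (e := v - 2 * u),
    progProd_eq_setProd hv (e := 2 * u), ← setProd_union, ← setProd_union] at key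
  · refine coeff_pos_of_mul_eq_setProd ?_ ?_ hF key n
    · rintro ((⟨k, hk⟩ | ⟨k, hk⟩) | ⟨k, hk⟩) <;> dsimp only at hk <;> omega
    · rintro ((⟨k, hk⟩ | ⟨k, hk⟩) | ⟨k, hk⟩) <;> dsimp only at hk <;> omega
  · rw [Set.disjoint_left]
    rintro _ (⟨k, rfl⟩ | ⟨k, rfl⟩) ⟨l, hl⟩
    · exact hsep _ _ _ _ (by omega) (by omega) hl
    · rcases lt_or_gt_of_ne (show 2 * u ≠ v - 2 * u by omega) with hlt | hgt
      · exact hsep _ _ _ _ hlt (by omega) hl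
      · exact hsep _ _ _ _ hgt (by omega) hl.symm
  · rw [Set.disjoint_left]
    rintro _ ⟨k, rfl⟩ ⟨l, hl⟩
    exact hsep _ _ _ _ (by omega) (by omega) hl

/-! ### Euler products as pentagonal series, and sections along residue classes. -/

theorem eulerProd_eq_progProd (m : ℕ) : eulerProd m = progProd m m := by
  simp only [eulerProd, qPochhammerInf, progProd, ← pow_mul, ← pow_add]

theorem continuous_expand {m : ℕ} (hm : m ≠ 0) :
    Continuous (expand m hm : ℤ⟦X⟧ →ₐ[ℤ] ℤ⟦X⟧) := by
  refine continuous_iff_continuousAt.mpr fun f => ?_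
  refine (WithPiTopology.tendsto_iff_coeff_tendsto ℤ _ _ _).mpr fun d => ?_
  simp only [coeff_expand]
  split_ifs
  · exact (WithPiTopology.continuous_coeff ℤ _).tendsto f
  · exact tendsto_const_nhds

theorem eulerProd_eq_expand {m : ℕ} (hm : m ≠ 0) :
    eulerProd m = expand m hm (pentagonalSeries ℤ) := by
  have h := (WithPiTopology.hasProd_one_sub_X_pow ℤ).map (expand m hm) (continuous_expand hm)
  rw [eulerProd_eq_progProd, progProd, ← h.tprod_eq]
  refine tprod_congr fun k => ?_
  simp only [Function.comp_apply, map_sub, map_one, map_pow, expand_X]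
  rw [← pow_mul, mul_add, mul_one, add_comm]

theorem hasSum_eulerProd {m : ℕ} (hm : m ≠ 0) :
    HasSum (fun k : ℤ => (Int.negOnePow k : ℤ⟦X⟧) * X ^ (m * pentagonal k)) (eulerProd m) := by
  rw [eulerProd_eq_expand hm]
  convert (WithPiTopology.hasSum_pentagonalSeries ℤ).map (expand m hm)
    (continuous_expand hm) using 2
  simp [pow_mul]

/-- The coefficients of a power series along the progression `s, s + p, s + 2 p, …`. -/
noncomputable def progSection (p s : ℕ) (f : ℤ⟦X⟧) : ℤ⟦X⟧ := mk fun n => coeff (s + p * n) f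

theorem coeff_progSection (p s : ℕ) (f : ℤ⟦X⟧) (n : ℕ) :
    coeff n (progSection p s f) = coeff (s + p * n) f := coeff_mk _ _

/-- A series in X^p only moves exponents by multiples of p, so class s of the product sees only
class s of f. -/
theorem progSection_mul_expand {p s : ℕ} (hp : p ≠ 0) (hs : s < p) (f g : ℤ⟦X⟧) :
    progSection p s (f * expand p hp g) = progSection p s f * g := by
  ext n
  rw [coeff_progSection, coeff_mul, coeff_mul]
  symm
  refine Finset.sum_of_injOn (fun x => (s + p * x.1, p * x.2)) ?_ ?_ ?_ ?_
  · rintro ⟨a, b⟩ _ ⟨c, d⟩ _ h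
    simpa [hp] using h
  · rintro ⟨a, b⟩ h
    simp only [Finset.mem_coe, Finset.HasAntidiagonal.mem_antidiagonal] at h ⊢
    rw [← h]; ring
  · rintro ⟨a, b⟩ h h'
    rw [Finset.HasAntidiagonal.mem_antidiagonal] at h
    dsimp only at h ⊢
    rw [coeff_expand, if_neg, mul_zero]
    rintro ⟨c, rfl⟩
    apply h'
    -- Uses s < p: a larger c would already give p c > s + p n.
    have hc : c ≤ n := by
      by_contra hc
      have := Nat.mul_le_mul_left p (Nat.succ_le_of_lt (not_le.mp hc))
      rw [Nat.mul_succ] at this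
      omega
    refine ⟨(n - c, c), by simp [hc], ?_⟩
    have : p * (n - c) + p * c = p * n := by rw [← mul_add, Nat.sub_add_cancel hc]
    ext <;> simp
    omega
  · rintro ⟨a, b⟩ h
    simp [coeff_progSection]

theorem HasSum.progSection {ι : Type*} {f : ι → ℤ⟦X⟧} {F : ℤ⟦X⟧} (h : HasSum f F) (p s : ℕ) :
    HasSum (fun i => progSection p s (f i)) (progSection p s F) := by
  rw [WithPiTopology.hasSum_iff_hasSum_coeff] at h ⊢
  intro d
  simp only [coeff_progSection]
  exact h _

theorem progSection_X_pow {p : ℕ} (hp : p ≠ 0) (s m : ℕ) :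
    progSection p s (X ^ (s + p * m)) = X ^ m := by
  ext n
  rw [coeff_progSection, coeff_X_pow, coeff_X_pow]
  congr 1
  simp [hp]

theorem progSection_X_pow_of_not_modEq {p s e : ℕ} (h : ¬ e ≡ s [MOD p]) :
    progSection p s (X ^ e) = 0 := by
  ext n
  rw [coeff_progSection, coeff_X_pow, if_neg, map_zero]
  rintro rfl
  apply h
  simp [Nat.ModEq]

theorem progSection_intCast_mul (p s : ℕ) (c : ℤ) (f : ℤ⟦X⟧) :
    progSection p s ((c : ℤ⟦X⟧) * f) = (c : ℤ⟦X⟧) * progSection p s f := by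
  have h : ∀ g : ℤ⟦X⟧, (c : ℤ⟦X⟧) * g = c • g := fun g => (zsmul_eq_mul g c).symm
  ext n
  rw [coeff_progSection, h, h, map_zsmul, map_zsmul, coeff_progSection]

/-! ### The p-dissection of the pentagonal series. -/

section Dissection

variable {p : ℕ} {c ε : ℤ}

/-- Completing the square: 24·pentagonal(k) + 1 = (6k - 1)², and 6c - 1 = -εp. -/
theorem pentagonal_add (hε : ε ^ 2 = 1) (hc : 6 * c = 1 - ε * p) (k : ℤ) :
    24 * (pentagonal (c + k) : ℤ) = 36 * k ^ 2 - 12 * ε * k * p + p ^ 2 - 1 := by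
  have h := two_mul_natCast_pentagonal (c + k)
  have h2 : 24 * (pentagonal (c + k) : ℤ) = (6 * c + 6 * k - 1) ^ 2 - 1 := by
    linear_combination 12 * h
  rw [h2, hc]
  linear_combination (p : ℤ) ^ 2 * hε

/-- The branch c + ε(w + pt) yields the first family of quintuple exponents; the mirrored branch c -
ε(w + pt) yields the second, in `mul_pentagonal_eq_expB`. -/
theorem mul_pentagonal_eq_expA {i w : ℕ} (hε : ε ^ 2 = 1) (hc : 6 * c = 1 - ε * p)
    (hi : 0 < i) (hw : 2 * w < p) (t : ℤ) :
    i * pentagonal (c + ε * (w + p * t)) =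
      i * pentagonal (c + ε * w) + p * quintExpA (i * w) (i * p) t := by
  have hA := natCast_quintExpA (u := i * w) (v := i * p) (by nlinarith) t
  have h1 := pentagonal_add hε hc (ε * (w + p * t))
  have h2 := pentagonal_add hε hc (ε * w)
  have h3 := two_mul_natCast_pentagonal t
  zify
  rw [hA]
  push_cast
  have h4 : (pentagonal (c + ε * (w + p * t)) : ℤ) =
      pentagonal (c + ε * w) + p * (3 * w * t + p * pentagonal t) := by
    have : 24 * (pentagonal (c + ε * (w + p * t)) : ℤ) =
      24 * (pentagonal (c + ε * w) + p * (3 * w * t + p * pentagonal t)) := by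
      linear_combination h1 - h2 - 12 * (p : ℤ) ^ 2 * h3 +
        (36 * ((w + p * t) ^ 2 - (w : ℤ) ^ 2) - 12 * p * (p * t)) * hε
    linarith
  rw [h4]; ring

theorem mul_pentagonal_eq_expB {i w : ℕ} (hε : ε ^ 2 = 1) (hc : 6 * c = 1 - ε * p)
    (hi : 0 < i) (hw : 2 * w < p) (t : ℤ) :
    i * pentagonal (c - ε * (w + p * t)) =
      i * pentagonal (c + ε * w) + p * quintExpB (i * w) (i * p) t := by
  have hA := natCast_quintExpB (u := i * w) (v := i * p) (by nlinarith) t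
  have h1 := pentagonal_add hε hc (-(ε * (w + p * t)))
  have h2 := pentagonal_add hε hc (ε * w)
  have h3 := two_mul_natCast_pentagonal t
  rw [← sub_eq_add_neg] at h1
  zify
  rw [hA]
  push_cast
  have h4 : (pentagonal (c - ε * (w + p * t)) : ℤ) =
      pentagonal (c + ε * w) + p * (3 * w * t + p * pentagonal t + w + p * t) := by
    have : 24 * (pentagonal (c - ε * (w + p * t)) : ℤ) =
      24 * (pentagonal (c + ε * w) + p * (3 * w * t + p * pentagonal t + w + p * t)) := by
      linear_combination h1 - h2 - 12 * (p : ℤ) ^ 2 * h3 +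
        (36 * ((w + p * t) ^ 2 - (w : ℤ) ^ 2) + 12 * p * (2 * w + p * t)) * hε
    linarith
  rw [h4]; ring

/-- After completing the square the congruence says that p divides 36 (w - ε(k - c)) (w + ε(k - c)),
and p is prime to 36. -/
theorem eq_or_eq_of_mul_pentagonal_modEq {i : ℕ} {w : ℤ} (hp : p.Prime) (hp3 : 3 < p)
    (hpi : ¬ p ∣ i) (hε : ε ^ 2 = 1) (hc : 6 * c = 1 - ε * p) {k : ℤ}
    (h : i * pentagonal k ≡ i * pentagonal (c + ε * w) [MOD p]) :
    ∃ t : ℤ, k = c + ε * (w + p * t) ∨ k = c - ε * (w + p * t) := by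
  have hpz : Prime (p : ℤ) := Nat.prime_iff_prime_int.mp hp
  have h1 := pentagonal_add hε hc (k - c)
  have h2 := pentagonal_add hε hc (ε * w)
  rw [add_sub_cancel] at h1
  have hd := (Int.natCast_modEq_iff.mpr h).dvd
  have hd1 : (p : ℤ) ∣ i * (pentagonal (c + ε * w) - pentagonal k) := by
    push_cast at hd
    rwa [← mul_sub] at hd
  have hd2 := (hpz.dvd_or_dvd hd1).resolve_left fun h => hpi (by exact_mod_cast h)
  have hd3 : (p : ℤ) ∣ 36 * ((w - ε * (k - c)) * (w + ε * (k - c))) := by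
    obtain ⟨d, hd2⟩ := hd2
    refine ⟨24 * d + 12 * ε * (ε * w - (k - c)), ?_⟩
    linear_combination 24 * hd2 - h2 + h1 - 36 * (w ^ 2 + (k - c) ^ 2) * hε
  have h36 : ¬ (p : ℤ) ∣ 36 := by
    intro h
    have h' : p ∣ 36 := by exact_mod_cast h
    have : p ∣ 2 ^ 2 * 3 ^ 2 := by simpa using h'
    rcases (Nat.Prime.dvd_mul hp).mp this with h | h
    · have := Nat.le_of_dvd (by norm_num) (hp.dvd_of_dvd_pow h); omega
    · have := Nat.le_of_dvd (by norm_num) (hp.dvd_of_dvd_pow h); omega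
  rcases hpz.dvd_or_dvd ((hpz.dvd_or_dvd hd3).resolve_left h36) with ⟨t, ht⟩ | ⟨t, ht⟩
  · exact ⟨-t, Or.inl (by linear_combination (-ε) * ht - (k - c) * hε)⟩
  · exact ⟨-t, Or.inr (by linear_combination ε * ht - (k - c) * hε)⟩

/-- Both p and ε are odd, so εpt has the parity of t. -/
theorem negOnePow_add_mul (hpo : Odd p) (hε : ε ^ 2 = 1) (w t : ℤ) :
    Int.negOnePow (c + ε * (w + p * t)) = Int.negOnePow (c + ε * w) * Int.negOnePow t := by
  rw [← Int.negOnePow_add, Int.negOnePow_eq_iff]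
  have hεo : Odd ε := (Int.odd_pow' two_ne_zero).mp (hε ▸ odd_one)
  have hpo' : Odd (p : ℤ) := by exact_mod_cast hpo
  have : c + ε * (w + p * t) - (c + ε * w + t) = (ε * p - 1) * t := by ring
  rw [this]
  exact ((hεo.mul hpo').sub_odd odd_one).mul_right t

theorem negOnePow_sub_mul (hpo : Odd p) (hε : ε ^ 2 = 1) (w t : ℤ) :
    Int.negOnePow (c - ε * (w + p * t)) = Int.negOnePow (c + ε * w) * Int.negOnePow t := by
  rw [← negOnePow_add_mul hpo hε, Int.negOnePow_eq_iff]
  exact ⟨-(ε * (w + p * t)), by ring⟩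

end Dissection

theorem HasSum.congr_fun {f g : ℤ → ℤ⟦X⟧} {S : ℤ⟦X⟧} (h : ∀ t, f t = g t) (hg : HasSum g S) :
    HasSum f S := (funext h : f = g) ▸ hg

theorem hasSum_of_two_ranges {F : ℤ → ℤ⟦X⟧} {e₁ e₂ : ℤ → ℤ} (h₁ : Function.Injective e₁)
    (h₂ : Function.Injective e₂) (hd : ∀ s t, e₁ s ≠ e₂ t)
    (hF : ∀ k, F k ≠ 0 → k ∈ Set.range e₁ ∨ k ∈ Set.range e₂) {A B : ℤ⟦X⟧}
    (hA : HasSum (F ∘ e₁) A) (hB : HasSum (F ∘ e₂) B) : HasSum F (A + B) := by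
  have key : ∀ {e : ℤ → ℤ} (_ : Function.Injective e) {S : ℤ⟦X⟧} (_ : HasSum (F ∘ e) S),
      HasSum ((Set.range e).indicator F) S := fun {e} he {S} hS => by
    refine (he.hasSum_iff fun k hk => Set.indicator_of_notMem hk F).mp ?_
    have : (Set.range e).indicator F ∘ e = F ∘ e := funext fun t => by simp
    rwa [this]
  convert (key h₁ hA).add (key h₂ hB) using 2 with k
  by_cases hk1 : k ∈ Set.range e₁
  · rw [Set.indicator_of_mem hk1, Set.indicator_of_notMem, add_zero]
    obtain ⟨s, rfl⟩ := hk1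
    rintro ⟨t, ht⟩
    exact hd s t ht.symm
  · rw [Set.indicator_of_notMem hk1, zero_add]
    by_cases hk2 : k ∈ Set.range e₂
    · rw [Set.indicator_of_mem hk2]
    · rw [Set.indicator_of_notMem hk2]
      by_contra h
      exact (hF k h).elim hk1 hk2

section Dissection

variable {p : ℕ} {c ε : ℤ}

theorem progSection_term {i : ℕ} (hp : p ≠ 0) (k₀ : ℤ) {k t : ℤ} {d : ℕ}
    (hs : Int.negOnePow k = Int.negOnePow k₀ * Int.negOnePow t)
    (hd : i * pentagonal k = i * pentagonal k₀ + p * d) :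
    progSection p (i * pentagonal k₀ % p) ((Int.negOnePow k : ℤ⟦X⟧) * X ^ (i * pentagonal k)) =
      (Int.negOnePow k₀ : ℤ⟦X⟧) * X ^ (i * pentagonal k₀ / p) *
        ((Int.negOnePow t : ℤ⟦X⟧) * X ^ d) := by
  have e : i * pentagonal k = i * pentagonal k₀ % p + p * (i * pentagonal k₀ / p + d) := by
    rw [hd, mul_add, ← add_assoc, Nat.mod_add_div]
  rw [progSection_intCast_mul, e, progSection_X_pow hp, hs, pow_add]
  push_cast
  ring

theorem mul_ne_zero_of_sq_eq_one (hε : ε ^ 2 = 1) (hp : p ≠ 0) : ε * (p : ℤ) ≠ 0 := by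
  refine mul_ne_zero ?_ (by exact_mod_cast hp)
  rintro rfl
  norm_num at hε

theorem progSection_term_ne_zero {i : ℕ} {w : ℤ} (hp : p.Prime) (hp3 : 3 < p)
    (hpi : ¬ p ∣ i) (hε : ε ^ 2 = 1) (hc : 6 * c = 1 - ε * p) {k : ℤ}
    (h : progSection p (i * pentagonal (c + ε * w) % p)
      ((Int.negOnePow k : ℤ⟦X⟧) * X ^ (i * pentagonal k)) ≠ 0) :
    ∃ t : ℤ, k = c + ε * (w + p * t) ∨ k = c - ε * (w + p * t) := by
  refine eq_or_eq_of_mul_pentagonal_modEq hp hp3 hpi hε hc ?_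
  by_contra hk
  apply h
  rw [progSection_intCast_mul, progSection_X_pow_of_not_modEq, mul_zero]
  exact fun h => hk (h.trans (Nat.mod_modEq _ _))

/-- At w = 0 the two branches coincide under t ↦ -t, so only one is summed, and the pentagonal
number theorem resums it to an Euler product. -/
theorem progSection_eulerProd_zero {i : ℕ} (hp : p.Prime) (hp3 : 3 < p) (hi : 0 < i)
    (hpi : ¬ p ∣ i) (hε : ε ^ 2 = 1) (hc : 6 * c = 1 - ε * p) :
    progSection p (i * pentagonal c % p) (eulerProd i) =
      (Int.negOnePow c : ℤ⟦X⟧) * X ^ (i * pentagonal c / p) * progProd (i * p) (i * p) := by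
  have hsum := HasSum.progSection (hasSum_eulerProd hi.ne') p (i * pentagonal c % p)
  have hpo : Odd p := hp.odd_of_ne_two (by omega)
  have hinj : Function.Injective fun t : ℤ => c + ε * (((0 : ℕ) : ℤ) + p * t) := fun s t h => by
    have h0 := mul_ne_zero_of_sq_eq_one hε hp.ne_zero
    apply mul_left_cancel₀ h0
    dsimp only at h
    push_cast at h
    linarith
  refine hsum.unique ((hinj.hasSum_iff fun k hk => ?_).mp ?_)
  · by_contra h
    obtain ⟨t, rfl | rfl⟩ := progSection_term_ne_zero (w := 0) hp hp3 hpi hε hc (by simpa using h)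
    · exact hk ⟨t, by simp⟩
    · exact hk ⟨-t, by dsimp only; push_cast; ring⟩
  · rw [← eulerProd_eq_progProd]
    refine HasSum.congr_fun (fun t => ?_)
      ((hasSum_eulerProd (m := i * p) (mul_ne_zero hi.ne' hp.ne_zero)).mul_left _)
    have hA := mul_pentagonal_eq_expA (i := i) (w := 0) hε hc hi (by omega) t
    have e0 : c + ε * ((0 : ℕ) : ℤ) = c := by simp
    have hs := negOnePow_add_mul (c := c) hpo hε ((0 : ℕ) : ℤ) t
    rw [e0] at hA hs
    rw [Function.comp_apply, progSection_term hp.ne_zero c hs hA]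
    congr 3
    have := natCast_quintExpA (u := i * 0) (v := i * p) (by nlinarith) t
    zify
    rw [this]
    simp

theorem progSection_eulerProd {i w : ℕ} (hp : p.Prime) (hp3 : 3 < p) (hi : 0 < i)
    (hpi : ¬ p ∣ i) (hε : ε ^ 2 = 1) (hc : 6 * c = 1 - ε * p) (hw0 : 0 < w) (hw : 2 * w < p) :
    progSection p (i * pentagonal (c + ε * w) % p) (eulerProd i) =
      (Int.negOnePow (c + ε * w) : ℤ⟦X⟧) * X ^ (i * pentagonal (c + ε * w) / p) *
        quintSeries (i * w) (i * p) := by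
  have huv : 2 * (i * w) < i * p := by nlinarith
  have hsum := HasSum.progSection (hasSum_eulerProd hi.ne') p (i * pentagonal (c + ε * w) % p)
  have hpo : Odd p := hp.odd_of_ne_two (by omega)
  have h0 := mul_ne_zero_of_sq_eq_one hε hp.ne_zero
  have hA : Summable fun t : ℤ => (Int.negOnePow t : ℤ⟦X⟧) * X ^ quintExpA (i * w) (i * p) t := by
    refine summable_of_X_pow_natAbs_dvd fun t => Dvd.dvd.mul_left (pow_dvd_pow _ ?_) _
    have := abs_le_expA huv t
    rw [← natCast_quintExpA huv, Int.abs_eq_natAbs] at this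
    exact_mod_cast this
  have hB : Summable fun t : ℤ => (Int.negOnePow t : ℤ⟦X⟧) * X ^ quintExpB (i * w) (i * p) t := by
    refine summable_of_X_pow_natAbs_dvd fun t => Dvd.dvd.mul_left (pow_dvd_pow _ ?_) _
    have := abs_le_expB huv t
    rw [← natCast_quintExpB huv, Int.abs_eq_natAbs] at this
    exact_mod_cast this
  have hq : quintSeries (i * w) (i * p) = _ := (hasSum_quintSeries huv).unique
    (HasSum.congr_fun (fun t => mul_add _ _ _) (hA.hasSum.add hB.hasSum))
  rw [hq, mul_add]
  refine hsum.unique (hasSum_of_two_ranges (e₁ := fun t => c + ε * (w + p * t))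
    (e₂ := fun t => c - ε * (w + p * t)) (fun s t h => ?_) (fun s t h => ?_) (fun s t h => ?_)
    (fun k hk => ?_) ?_ ?_)
  · apply mul_left_cancel₀ h0
    dsimp only at h
    linarith
  · apply mul_left_cancel₀ h0
    dsimp only at h
    linarith
  -- A common index of the two branches would make p divide 2w, while 0 < 2w < p.
  · have h1 : 2 * (w : ℤ) = p * (-(s + t)) := by
      linear_combination ε * h - (2 * w + p * s + p * t) * hε
    have h2 : (p : ℤ) ∣ 2 * w := ⟨_, h1⟩
    have := Int.le_of_dvd (by positivity) h2
    omega
  · obtain ⟨t, rfl | rfl⟩ := progSection_term_ne_zero hp hp3 hpi hε hc hk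
    · exact Or.inl ⟨t, rfl⟩
    · exact Or.inr ⟨t, rfl⟩
  · refine HasSum.congr_fun (fun t => ?_) (hA.hasSum.mul_left _)
    exact progSection_term hp.ne_zero _ (negOnePow_add_mul hpo hε w t)
      (mul_pentagonal_eq_expA hε hc hi hw t)
  · refine HasSum.congr_fun (fun t => ?_) (hB.hasSum.mul_left _)
    exact progSection_term hp.ne_zero _ (negOnePow_sub_mul hpo hε w t)
      (mul_pentagonal_eq_expB hε hc hi hw t)

end Dissection

/-! ### Sign or vanishing of the coefficients on each residue class. -/

theorem eulerProd_ne_zero {m : ℕ} (hm : 0 < m) : eulerProd m ≠ 0 := fun h => by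
  have := constantCoeff_eulerProd hm
  simp [h] at this

theorem eulerProd_eq_expand_eulerProd_one {m : ℕ} (hm : m ≠ 0) :
    eulerProd m = expand m hm (eulerProd 1) := by
  rw [eulerProd_eq_expand hm, eulerProd_eq_expand one_ne_zero, expand_one_apply]

theorem progSection_mul_eulerProd_one {p : ℕ} (hp : p ≠ 0) {a b : ℤ⟦X⟧} (h : a * eulerProd p = b)
    {s : ℕ} (hs : s < p) : progSection p s a * eulerProd 1 = progSection p s b := by
  rw [← h, eulerProd_eq_expand_eulerProd_one hp, progSection_mul_expand hp hs]

theorem coeff_sign {p i : ℕ} {c ε : ℤ} {a : ℕ → ℤ} (hp : p.Prime) (hp3 : 3 < p) (hi : 1 < i)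
    (hpi : ¬ p ∣ i) (ha : mk a * eulerProd p = eulerProd i) (hε : ε ^ 2 = 1)
    (hc : 6 * c = 1 - ε * p) {w n : ℕ} (hw : 2 * w < p)
    (hn : n ≡ i * pentagonal (c + ε * w) [MOD p]) (hle : i * pentagonal (c + ε * w) ≤ n) :
    0 < (Int.negOnePow (c + ε * w) : ℤ) * a n := by
  set e := i * pentagonal (c + ε * w) with he
  obtain ⟨D, hD, hpos⟩ : ∃ D : ℤ⟦X⟧, progSection p (e % p) (eulerProd i) =
      (Int.negOnePow (c + ε * w) : ℤ⟦X⟧) * X ^ (e / p) * D ∧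
      ∀ b : ℤ⟦X⟧, b * progProd 1 1 = D → ∀ m, 0 < coeff m b := by
    rcases Nat.eq_zero_or_pos w with rfl | hw0
    · refine ⟨progProd (i * p) (i * p), ?_,
        fun b hb => coeff_pos_of_mul_eq_progProd (by nlinarith) hb⟩
      have := progSection_eulerProd_zero hp hp3 (by omega) hpi hε hc
      simpa [he] using this
    · refine ⟨quintSeries (i * w) (i * p),
        progSection_eulerProd hp hp3 (by omega) hpi hε hc hw0 hw, fun b hb =>
        -- Here i > 1 is needed: v - 2u = i(p - 2w) must be at least 2. The excluded case 4u = v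
        -- would make p even.
        coeff_pos_of_mul_eq_quintSeries (by positivity) (by nlinarith) (fun h => ?_) hb⟩
      have h4 : 4 * w = p := by
        apply Nat.eq_of_mul_eq_mul_left (by omega : 0 < i)
        linarith
      have : 2 ∣ p := ⟨2 * w, by omega⟩
      rcases (Nat.dvd_prime hp).mp this with h | h <;> omega
  have h1 := progSection_mul_eulerProd_one hp.ne_zero ha (Nat.mod_lt e hp.pos)
  obtain ⟨g, hg⟩ : ∃ g, eulerProd 1 * g = 1 := by
    have : IsUnit (eulerProd 1) := by
      rw [isUnit_iff_constantCoeff, constantCoeff_eulerProd one_pos]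
      exact isUnit_one
    exact this.exists_right_inv
  have hsec : progSection p (e % p) (mk a) =
      (Int.negOnePow (c + ε * w) : ℤ⟦X⟧) * X ^ (e / p) * (D * g) := by
    linear_combination g * h1 + g * hD - progSection p (e % p) (mk a) * hg
  obtain ⟨m, hm⟩ := (Nat.modEq_iff_dvd' hle).mp hn.symm
  -- The position of n in its section is m steps past the leading monomial X^(e / p).
  have hn' : n = e % p + p * (m + e / p) := by
    have := Nat.mod_add_div e p
    rw [mul_add]
    omega
  have hcoeff := congrArg (coeff (m + e / p)) hsec
  rw [coeff_progSection, ← hn', coeff_mk, mul_assoc, ← zsmul_eq_mul, map_zsmul, coeff_X_pow_mul,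
    smul_eq_mul] at hcoeff
  rw [hcoeff, ← mul_assoc, ← Units.val_mul, ← sq, Int.units_sq, Units.val_one, one_mul]
  refine hpos _ ?_ m
  rw [← eulerProd_eq_progProd]
  linear_combination D * hg

/-- The pentagonal number of -2r is 6r² + r, and every k is congruent to some -2r as p is odd.
Outside these classes the section of the numerator vanishes, hence so does that of the quotient. -/
theorem coeff_eq_zero_of_not_modEq {p i : ℕ} {a : ℕ → ℤ} (hp : p.Prime) (hp3 : 3 < p) (hi : 0 < i)
    (ha : mk a * eulerProd p = eulerProd i) {n : ℕ}
    (hn : ∀ r < p, ¬ n ≡ i * (6 * r ^ 2 + r) [MOD p]) : a n = 0 := by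
  have hk : ∀ k : ℤ, ¬ i * pentagonal k ≡ n % p [MOD p] := by
    intro k hk
    obtain ⟨h, hh⟩ := hp.odd_of_ne_two (by omega)
    -- With p = 2h + 1 one has -2h ≡ 1, so -2r ≡ k.
    set r : ℕ := ((k * h) % p).toNat with hr
    have hp0 : (0 : ℤ) < p := by exact_mod_cast hp.pos
    have hr' : (r : ℤ) = (k * h) % p := Int.toNat_of_nonneg (Int.emod_nonneg _ hp0.ne')
    have hrp : r < p := by
      have := Int.emod_lt_of_pos (k * h) hp0
      omega
    apply hn r hrp
    refine (Nat.mod_modEq n p).symm.trans (hk.symm.trans ?_)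
    refine Nat.ModEq.mul_left _ ?_
    refine Nat.ModEq.cancel_left_of_coprime (c := 2) ?_ ?_
    · rw [Nat.gcd_comm]
      exact (Nat.coprime_primes Nat.prime_two hp).mpr (by omega)
    · rw [← Int.natCast_modEq_iff]
      push_cast
      rw [two_mul_natCast_pentagonal]
      have hd : (p : ℤ) ∣ k + 2 * r := by
        have h1 := Int.emod_add_mul_ediv (k * h) p
        rw [← hr'] at h1
        refine ⟨k - 2 * (k * h / p), ?_⟩
        have h2 : (p : ℤ) = 2 * h + 1 := by exact_mod_cast hh
        linear_combination 2 * h1 - k * h2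
      obtain ⟨t, ht⟩ := hd
      refine Int.modEq_iff_dvd.mpr ⟨t * (6 * r + 1 - 3 * k), ?_⟩
      linear_combination (6 * r + 1 - 3 * k) * ht
  have h1 := progSection_mul_eulerProd_one hp.ne_zero ha (Nat.mod_lt n hp.pos)
  have h2 : progSection p (n % p) (eulerProd i) = 0 := by
    refine (HasSum.progSection (hasSum_eulerProd hi.ne') p (n % p)).unique ?_
    refine HasSum.congr_fun (fun k => ?_) hasSum_zero
    rw [progSection_intCast_mul, progSection_X_pow_of_not_modEq (hk k), mul_zero]
  rw [h2] at h1
  have h3 := congrArg (coeff (n / p))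
    ((mul_eq_zero.mp h1).resolve_right (eulerProd_ne_zero one_pos))
  rwa [coeff_progSection, Nat.mod_add_div, coeff_mk, map_zero] at h3

/-! ### The values 𝓛(r) as pentagonal numbers of centred indices. -/

/-- The index `k` of the pentagonal number `𝓛(r) = k (3 k - 1) / 2`, relative to `c`. -/
def IsIndex (p : ℕ) (c ε : ℤ) (r : ℕ) (κ : ℤ) : Prop :=
  2 * |κ| < p ∧ calL p r = pentagonal (c + ε * κ) ∧ calL p r ≡ 6 * r ^ 2 + r [ZMOD p] ∧
    (Even (c + ε * κ) ↔ (r : ℚ) ≤ cutLow p ∨ cutHigh p < (r : ℚ))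

theorem isIndex_of_eq {p r : ℕ} {c ε κ : ℤ} (h1 : -(p : ℤ) < 2 * κ ∧ 2 * κ < p)
    (h2 : 2 * calL p r = (c + ε * κ) * (3 * (c + ε * κ) - 1))
    (h3 : (p : ℤ) ∣ 6 * r ^ 2 + r - calL p r)
    (h4 : Even (c + ε * κ) ↔ (r : ℚ) ≤ cutLow p ∨ cutHigh p < (r : ℚ)) : IsIndex p c ε r κ :=
  ⟨by cases abs_cases κ <;> omega, by linarith [two_mul_natCast_pentagonal (c + ε * κ)],
    Int.modEq_iff_dvd.mpr h3, h4⟩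

/-- The three ranges of r use the indices -2r, 2c + 2r - p and 2p - 2r: the middle one is the
reflection of -2r about c, shifted by p, hence odd, and the outer ones are even. The cut-points are
where κ would leave (-p/2, p/2). The same three formulas serve p = 6q + 5. -/
theorem exists_isIndex_of_six_mul_add_one (q : ℕ) {r : ℕ} (hr : r < 6 * q + 1) :
    ∃ κ, IsIndex (6 * q + 1) (-q) 1 r κ := by
  have hp : 6 * q + 1 ≡ 1 [MOD 3] := by simp [Nat.ModEq]; omega
  have hlow : (r : ℚ) ≤ cutLow (6 * q + 1) ↔ r ≤ 2 * q := by
    rw [cutLow, if_pos hp, le_div_iff₀ (by norm_num)]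
    push_cast
    rw [← Nat.lt_succ_iff, show (r : ℚ) * 12 ≤ 4 * (6 * q + 1) - 1 ↔
      ((r * 12 : ℕ) : ℚ) ≤ ((24 * q + 3 : ℕ) : ℚ) by push_cast; constructor <;> intro <;> linarith,
      Nat.cast_le]
    omega
  have hhigh : (r : ℚ) ≤ cutHigh (6 * q + 1) ↔ r ≤ 5 * q := by
    rw [cutHigh, if_pos hp, le_div_iff₀ (by norm_num)]
    push_cast
    rw [← Nat.lt_succ_iff, show (r : ℚ) * 12 ≤ 10 * (6 * q + 1) - 1 ↔
      ((r * 12 : ℕ) : ℚ) ≤ ((60 * q + 9 : ℕ) : ℚ) by push_cast; constructor <;> intro <;> linarith,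
      Nat.cast_le]
    omega
  have hL : calL (6 * q + 1) r = if r ≤ 2 * q then 6 * (r : ℤ) ^ 2 + r
      else if r ≤ 5 * q then 6 * (r : ℤ) ^ 2 + r - 8 * (6 * q + 1) * r + (6 * q + 1) * (16 * q + 2)
      else 6 * (r : ℤ) ^ 2 + r - 12 * (6 * q + 1) * r + (6 * (6 * q + 1) ^ 2 - (6 * q + 1)) := by
    have e : (8 * ((6 * q + 1 : ℕ) : ℤ) ^ 2 - 2 * (6 * q + 1 : ℕ)) / 3 =
        (6 * q + 1) * (16 * q + 2) :=
      Int.ediv_eq_of_eq_mul_right (by norm_num) (by push_cast; ring)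
    rw [calL, if_pos hp, e]
    simp only [hlow, hhigh]
    push_cast
    rfl
  rcases le_or_gt r (2 * q) with h1 | h1
  · refine ⟨-2 * r + q, isIndex_of_eq ?_ ?_ ?_ ?_⟩
    · push_cast; omega
    · rw [hL, if_pos h1]; ring
    · rw [hL, if_pos h1, sub_self]; exact dvd_zero _
    · rw [hlow]; simp only [h1, true_or, iff_true]; exact ⟨-r, by ring⟩
  rcases le_or_gt r (5 * q) with h2 | h2
  · refine ⟨2 * r - 7 * q - 1, isIndex_of_eq ?_ ?_ ?_ ?_⟩
    · push_cast; omega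
    · rw [hL, if_neg (by omega), if_pos h2]; ring
    · rw [hL, if_neg (by omega), if_pos h2]
      exact ⟨8 * r - (16 * q + 2), by push_cast; ring⟩
    · rw [hlow, ← not_le, hhigh, Int.even_iff]; omega
  · refine ⟨13 * q + 2 - 2 * r, isIndex_of_eq ?_ ?_ ?_ ?_⟩
    · push_cast; omega
    · rw [hL, if_neg (by omega), if_neg (by omega)]; ring
    · rw [hL, if_neg (by omega), if_neg (by omega)]
      exact ⟨12 * r - (6 * (6 * q + 1) - 1), by push_cast; ring⟩
    · rw [hlow, ← not_le, hhigh, Int.even_iff]; omega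

theorem exists_isIndex_of_six_mul_add_five (q : ℕ) {r : ℕ} (hr : r < 6 * q + 5) :
    ∃ κ, IsIndex (6 * q + 5) (q + 1) (-1) r κ := by
  have hp : ¬ 6 * q + 5 ≡ 1 [MOD 3] := by simp [Nat.ModEq]; omega
  have hlow : (r : ℚ) ≤ cutLow (6 * q + 5) ↔ r ≤ q := by
    rw [cutLow, if_neg hp, le_div_iff₀ (by norm_num)]
    push_cast
    rw [← Nat.lt_succ_iff, show (r : ℚ) * 12 ≤ 2 * (6 * q + 5) - 1 ↔
      ((r * 12 : ℕ) : ℚ) ≤ ((12 * q + 9 : ℕ) : ℚ) by push_cast; constructor <;> intro <;> linarith,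
      Nat.cast_le]
    omega
  have hhigh : (r : ℚ) ≤ cutHigh (6 * q + 5) ↔ r ≤ 4 * q + 3 := by
    rw [cutHigh, if_neg hp, le_div_iff₀ (by norm_num)]
    push_cast
    rw [← Nat.lt_succ_iff, show (r : ℚ) * 12 ≤ 8 * (6 * q + 5) - 1 ↔
      ((r * 12 : ℕ) : ℚ) ≤ ((48 * q + 39 : ℕ) : ℚ) by push_cast; constructor <;> intro <;> linarith,
      Nat.cast_le]
    omega
  have hL : calL (6 * q + 5) r = if r ≤ q then 6 * (r : ℤ) ^ 2 + r
      else if r ≤ 4 * q + 3 then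
        6 * (r : ℤ) ^ 2 + r - 4 * (6 * q + 5) * r + (6 * q + 5) * (4 * q + 3)
      else 6 * (r : ℤ) ^ 2 + r - 12 * (6 * q + 5) * r + (6 * (6 * q + 5) ^ 2 - (6 * q + 5)) := by
    have e : (2 * ((6 * q + 5 : ℕ) : ℤ) ^ 2 - (6 * q + 5 : ℕ)) / 3 = (6 * q + 5) * (4 * q + 3) :=
      Int.ediv_eq_of_eq_mul_right (by norm_num) (by push_cast; ring)
    rw [calL, if_neg hp, e]
    simp only [hlow, hhigh]
    push_cast
    rfl
  rcases le_or_gt r q with h1 | h1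
  · refine ⟨q + 1 + 2 * r, isIndex_of_eq ?_ ?_ ?_ ?_⟩
    · push_cast; omega
    · rw [hL, if_pos h1]; ring
    · rw [hL, if_pos h1, sub_self]; exact dvd_zero _
    · rw [hlow]; simp only [h1, true_or, iff_true]; exact ⟨-r, by ring⟩
  rcases le_or_gt r (4 * q + 3) with h2 | h2
  · refine ⟨5 * q + 4 - 2 * r, isIndex_of_eq ?_ ?_ ?_ ?_⟩
    · push_cast; omega
    · rw [hL, if_neg (by omega), if_pos h2]; ring
    · rw [hL, if_neg (by omega), if_pos h2]
      exact ⟨4 * r - (4 * q + 3), by push_cast; ring⟩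
    · rw [hlow, ← not_le, hhigh, Int.even_iff]; omega
  · refine ⟨2 * r - 11 * q - 9, isIndex_of_eq ?_ ?_ ?_ ?_⟩
    · push_cast; omega
    · rw [hL, if_neg (by omega), if_neg (by omega)]; ring
    · rw [hL, if_neg (by omega), if_neg (by omega)]
      exact ⟨12 * r - (6 * (6 * q + 5) - 1), by push_cast; ring⟩
    · rw [hlow, ← not_le, hhigh, Int.even_iff]; omega

theorem exists_isIndex {p : ℕ} (hp : p.Prime) (hp3 : 3 < p) :
    ∃ c ε : ℤ, ε ^ 2 = 1 ∧ 6 * c = 1 - ε * p ∧ ∀ r < p, ∃ κ, IsIndex p c ε r κ := by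
  have h2 : p % 2 ≠ 0 := fun h => by
    rcases (Nat.dvd_prime hp).mp (Nat.dvd_of_mod_eq_zero h) with h | h <;> omega
  have h3 : p % 3 ≠ 0 := fun h => by
    rcases (Nat.dvd_prime hp).mp (Nat.dvd_of_mod_eq_zero h) with h | h <;> omega
  have h6 : p = 6 * (p / 6) + 1 ∨ p = 6 * (p / 6) + 5 := by omega
  generalize p / 6 = q at h6
  rcases h6 with rfl | rfl
  · exact ⟨-q, 1, by norm_num, by push_cast; ring,
      fun r hr => exists_isIndex_of_six_mul_add_one q hr⟩
  · exact ⟨q + 1, -1, by norm_num, by push_cast; ring,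
      fun r hr => exists_isIndex_of_six_mul_add_five q hr⟩

/-! ### The bound N and the final sign. -/

theorem exists_mul_calL_le {p i n s : ℕ} (hp : 0 < p) (hn : boundN p i < n) (hs : s < p)
    (hns : n ≡ s [MOD p]) (hne : (classValues p i s).Nonempty) :
    ∃ r < p, (i : ℤ) * calL p r ≡ n [ZMOD p] ∧ (i : ℤ) * calL p r ≤ n := by
  set m := (classValues p i s).min' hne with hm
  have hmem : m ∈ classValues p i s := Finset.min'_mem _ _
  have hmin : m ∈ classMinima p i :=
    Finset.mem_biUnion.mpr ⟨s, Finset.mem_range.mpr hs,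
      Finset.mem_filter.mpr ⟨hmem, fun x hx => Finset.min'_le _ _ hx⟩⟩
  have hle := (isGreatest_boundN i hp).2 hmin
  obtain ⟨h1, h2⟩ := Finset.mem_filter.mp hmem
  obtain ⟨r, hr, hrm⟩ := Finset.mem_image.mp h1
  have hmod : m ≡ n [ZMOD p] := h2.trans (Int.natCast_modEq_iff.mpr hns).symm
  refine ⟨r, Finset.mem_range.mp hr, hrm ▸ hmod, hrm.symm ▸ ?_⟩
  obtain ⟨t, ht⟩ := hmod.dvd
  have hp' : (0 : ℤ) < p := by exact_mod_cast hp
  -- The class minimum m satisfies m ≤ N + p < n + p, so n - m = pt exceeds -p, which forces t ≥ 0.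
  have : -1 < t := by
    by_contra hcon
    have : t ≤ -1 := by omega
    nlinarith
  nlinarith

theorem eq_of_eq_add_mul_of_abs_lt {p : ℕ} {κ κ' t : ℤ} (h : 2 * |κ| < p) (h' : 2 * |κ'| < p)
    (ht : κ' = κ + p * t) : κ' = κ := by
  have h1 : |κ' - κ| < p := by
    have := abs_sub κ' κ
    linarith
  have h2 : (p : ℤ) ∣ κ' - κ := ⟨t, by rw [ht]; ring⟩
  exact sub_eq_zero.mp (Int.eq_zero_of_abs_lt_dvd h2 h1)

/-- The r' supplied by the bound need not be r, but its index parameter is ±κ. Both choices give the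
same parity, and with w = |κ| the index c + εw has the smaller pentagonal number, so `coeff_sign`
applies in either case. -/
theorem sign_of_boundN_lt {p i : ℕ} {a : ℕ → ℤ} (hp : p.Prime) (hp3 : 3 < p) (hi : 1 < i)
    (hpi : ¬ p ∣ i) (ha : mk a * eulerProd p = eulerProd i) {n r : ℕ} (hn : boundN p i < n)
    (hr : r < p) (hnr : n ≡ i * (6 * r ^ 2 + r) [MOD p]) :
    (((r : ℚ) ≤ cutLow p ∨ cutHigh p < (r : ℚ)) → 0 < a n) ∧
      ((cutLow p < (r : ℚ) ∧ (r : ℚ) ≤ cutHigh p) → a n < 0) := by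
  obtain ⟨c, ε, hε, hc, hidx⟩ := exists_isIndex hp hp3
  obtain ⟨κ, hκ, hL, hmod, heven⟩ := hidx r hr
  have hnL : (n : ℤ) ≡ i * calL p r [ZMOD p] := by
    have := Int.natCast_modEq_iff.mpr hnr
    push_cast at this
    exact this.trans (hmod.symm.mul_left _)
  have hne : (classValues p i (n % p)).Nonempty := by
    refine ⟨i * calL p r, Finset.mem_filter.mpr ⟨Finset.mem_image.mpr
      ⟨r, Finset.mem_range.mpr hr, rfl⟩, hnL.symm.trans ?_⟩⟩
    push_cast
    exact (Int.mod_modEq _ _).symm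
  obtain ⟨r', hr', hmod', hle'⟩ := exists_mul_calL_le hp.pos hn (Nat.mod_lt n hp.pos)
    (Nat.mod_modEq n p).symm hne
  obtain ⟨κ', hκ', hL', -, -⟩ := hidx r' hr'
  rw [hL'] at hmod' hle'
  rw [hL] at hnL
  have hκκ : κ' = κ ∨ κ' = -κ := by
    have h : i * pentagonal (c + ε * κ') ≡ i * pentagonal (c + ε * κ) [MOD p] := by
      rw [← Int.natCast_modEq_iff]
      push_cast
      exact hmod'.trans hnL
    obtain ⟨t, ht | ht⟩ := eq_or_eq_of_mul_pentagonal_modEq hp hp3 hpi hε hc h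
    · left
      exact eq_of_eq_add_mul_of_abs_lt hκ hκ' (t := t)
        (by linear_combination ε * ht - (κ' - κ - p * t) * hε)
    · right
      exact eq_of_eq_add_mul_of_abs_lt (by rwa [abs_neg]) hκ' (t := -t)
        (by linear_combination ε * ht - (κ' + κ + p * t) * hε)
  obtain ⟨w, hw⟩ : ∃ w : ℕ, (w : ℤ) = |κ| := ⟨κ.natAbs, by simp⟩
  have hκw : κ = w ∨ κ = -w := by
    rw [hw]; exact (abs_choice κ).elim (fun h => .inl h.symm) (fun h => .inr (by rw [h, neg_neg]))
  have hpent : ∀ k : ℤ, k = w ∨ k = -w → ∃ d : ℕ,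
      pentagonal (c + ε * k) = pentagonal (c + ε * w) + p * d := by
    rintro k (rfl | rfl)
    · exact ⟨0, by simp⟩
    -- The linear term of the completed square gives pentagonal(c - εw) = pentagonal(c + εw) + pw.
    · refine ⟨w, ?_⟩
      have h1 := pentagonal_add hε hc (ε * -(w : ℤ))
      have h2 := pentagonal_add hε hc (ε * w)
      zify
      have : 24 * (pentagonal (c + ε * -(w : ℤ)) : ℤ) = 24 * (pentagonal (c + ε * w) + p * w) := by
        linear_combination h1 - h2 + 24 * p * w * hε
      linarith
  have hsign : Int.negOnePow (c + ε * κ) = Int.negOnePow (c + ε * w) := by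
    rw [Int.negOnePow_eq_iff]
    rcases hκw with h | h <;> rw [h]
    · simp
    · exact ⟨-(ε * w), by ring⟩
  have hpos : 0 < (Int.negOnePow (c + ε * w) : ℤ) * a n := by
    refine coeff_sign hp hp3 hi hpi ha hε hc (by rw [← hw] at hκ; exact_mod_cast hκ) ?_ ?_
    · obtain ⟨d, hd⟩ := hpent κ hκw
      rw [hd] at hnL
      have : n ≡ i * (pentagonal (c + ε * w) + p * d) [MOD p] := by
        rw [← Int.natCast_modEq_iff]
        push_cast at hnL ⊢
        exact hnL
      refine this.trans (Nat.ModEq.mul_left _ ?_)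
      simp [Nat.ModEq]
    · obtain ⟨d, hd⟩ := hpent κ' (by
        rcases hκκ with h | h <;> rcases hκw with h' | h' <;> simp [h, h'])
      rw [hd] at hle'
      have : i * (pentagonal (c + ε * w) + p * d) ≤ n := by exact_mod_cast hle'
      exact (Nat.mul_le_mul_left i (Nat.le_add_right _ _)).trans this
  rw [← hsign] at hpos
  constructor
  · intro h
    rw [Int.negOnePow_even _ (heven.mpr h)] at hpos
    simpa using hpos
  · rintro ⟨h1, h2⟩
    have : ¬ Even (c + ε * κ) := fun h => (heven.mp h).elim (not_le.mpr h1) (not_lt.mpr h2)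
    rw [Int.negOnePow_odd _ (Int.not_even_iff_odd.mp this)] at hpos
    simpa using hpos

end SignPattern

theorem theorem1p1 (p i : ℕ) (hp : p.Prime) (hp3 : 3 < p) (hi : 1 < i) (hpi : ¬ p ∣ i)
    (a : ℕ → ℤ)
    (ha : PowerSeries.mk a * SignPattern.eulerProd p = SignPattern.eulerProd i) :
    (∀ n : ℕ, (∀ r : ℕ, r < p → ¬ n ≡ i * (6 * r ^ 2 + r) [MOD p]) → a n = 0) ∧
    (p ≡ 1 [MOD 3] → ∀ n : ℕ, SignPattern.boundN p i < (n : ℤ) →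
      ∀ r : ℕ, r < p → n ≡ i * (6 * r ^ 2 + r) [MOD p] →
        (((r : ℚ) ≤ (4 * p - 1) / 12 ∨ (10 * p - 1) / 12 < (r : ℚ)) → 0 < a n) ∧
        (((4 * p - 1) / 12 < (r : ℚ) ∧ (r : ℚ) ≤ (10 * p - 1) / 12) → a n < 0)) ∧
    ((p : ℤ) ≡ -1 [ZMOD 3] → ∀ n : ℕ, SignPattern.boundN p i < (n : ℤ) →
      ∀ r : ℕ, r < p → n ≡ i * (6 * r ^ 2 + r) [MOD p] →
        (((r : ℚ) ≤ (2 * p - 1) / 12 ∨ (8 * p - 1) / 12 < (r : ℚ)) → 0 < a n) ∧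
        (((2 * p - 1) / 12 < (r : ℚ) ∧ (r : ℚ) ≤ (8 * p - 1) / 12) → a n < 0)) := by
  refine ⟨fun n hn => SignPattern.coeff_eq_zero_of_not_modEq hp hp3 (by omega) ha hn,
    fun h1 n hn r hr hnr => ?_, fun h1 n hn r hr hnr => ?_⟩
  · have := SignPattern.sign_of_boundN_lt hp hp3 hi hpi ha hn hr hnr
    rwa [SignPattern.cutLow, SignPattern.cutHigh, if_pos h1, if_pos h1] at this
  · have h2 : ¬ p ≡ 1 [MOD 3] := fun h => by
      rw [Nat.ModEq] at h
      rw [Int.ModEq] at h1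
      omega
    have := SignPattern.sign_of_boundN_lt hp hp3 hi hpi ha hn hr hnr
    rwa [SignPattern.cutLow, SignPattern.cutHigh, if_neg h2, if_neg h2] at this
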